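/- Let $I\subset\mathbb R$ be an open interval, $D,f\in C^2(I)$, $\alpha<\beta$ with $[\alpha,\beta]\subset I$, and assume that $D(u)\ge d>0$ for all $u\in I$, $f(\alpha)=f(\beta)=0$, $f'(\alpha)>0$, $f'(\beta)>0$, $\int_\alpha^\beta f(s)D(s)\,ds=0$, and $G(u):=\int_\alpha^u f(s)D(s)\,ds>0$ for all $u\in I\setminus\{\alpha,\beta\}$. Let $a<b$ and, for $\varepsilon>0$ and $w\in H^1(a,b)$ with values in $I$, put $$E_\varepsilon[w]=\int_a^b\Big\{\frac{\varepsilon}{2}\,[D(w)w_x]^2+\frac{G(w)}{\varepsilon}\Big\}\,dx,\qquad \gamma_0=\int_\alpha^\beta\sqrt{2G(s)}\,D(s)\,ds,\qquad \lambda=\min\Big\{\frac{f'(\alpha)}{D(\alpha)},\frac{f'(\beta)}{D(\beta)}\Big\}.$$ Let $v:[a,b]\to\{\alpha,\beta\}$ be piecewise constant with exactly $N$ jumps, located at $h_1<\dots<h_N$, and let $r>0$ satisfy $h_i+r<h_{i+1}-r$ for $1\le i<N$, $a\le h_1-r$ and $h_N+r\le b$. Let $A\in(0,r\sqrt{2\lambda})$.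 Let $u_0^\varepsilon$ ($\varepsilon>0$) be functions such that, for all sufficiently small $\varepsilon>0$, $u_0^\varepsilon\in H^1(a,b)$ (continuous representative) takes its values in a compact interval $[M_1,M_2]\subset I$ and $$E_\varepsilon[u_0^\varepsilon]\le N\gamma_0+C\,e^{-A/\varepsilon}$$ with a constant $C>0$ independent of $\varepsilon$, and such that $\|u_0^\varepsilon-v\|_{L^1(a,b)}\to0$ as $\varepsilon\to0^+$. Then there are constants $\varepsilon_0,C_1,C_2>0$, independent of $\varepsilon$, such that for every $\varepsilon\in(0,\varepsilon_0)$ the following holds. If $u^\varepsilon$ is a solution, with values in $I$, of $$u_t=\varepsilon^2(D(u)u_x)_x-f(u)\ \text{ in }(a,b)\times(0,\infty),\qquad u_x(a,t)=u_x(b,t)=0\ \ (t>0),\qquad u(\cdot,0)=u_0^\varepsilon,$$ in the sense that $u^\varepsilon\in C([0,\infty);H^1(a,b))\cap C((0,\infty);H^2(a,b))$ is differentiable in time as a map $(0,\infty)\to L^2(a,b)$ and satisfies the equation in $L^2(a,b)$ for every $t>0$, then $$\int_0^{C_1\varepsilon^{-1}e^{A/\varepsilon}}\|u_t^\varepsilon(\cdot,t)\|_{L^2(a,b)}^2\,dt\le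 C_2\,\varepsilon\,e^{-A/\varepsilon}.$$ -/

import Mathlib

open Set Filter Topology MeasureTheory

namespace AllenCahn

noncomputable section

/-- The spatial derivative on `[a, b]` (one-sided at the two end points). -/
def dx (a b : ℝ) (w : ℝ → ℝ) : ℝ → ℝ := derivWithin w (Icc a b)

/-- `w` is the continuous representative of an element of the Sobolev space `H¹(a, b)`: it is
absolutely continuous on `[a, b]` and its almost everywhere derivative is in `L²(a, b)`. -/
def MemH1 (a b : ℝ) (w : ℝ → ℝ) : Prop :=
  AbsolutelyContinuousOnInterval w a b ∧ MemLp (dx a b w) 2 (volume.restrict (Ioo a b))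

/-- `w` is the `C¹` representative of an element of the Sobolev space `H²(a, b)`. -/
def MemH2 (a b : ℝ) (w : ℝ → ℝ) : Prop :=
  MemH1 a b w ∧ DifferentiableOn ℝ w (Icc a b) ∧ MemH1 a b (dx a b w)

/-- The `L^p(a, b)` norm of a function, with values in `[0, ∞]`. -/
def normL (a b : ℝ) (p : ENNReal) (w : ℝ → ℝ) : ENNReal :=
  eLpNorm w p (volume.restrict (Ioo a b))

/-- The norm of `H¹(a, b)`. -/
def h1Norm (a b : ℝ) (w : ℝ → ℝ) : ENNReal :=
  normL a b 2 w + normL a b 2 (dx a b w)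

/-- The norm of `H²(a, b)`. -/
def h2Norm (a b : ℝ) (w : ℝ → ℝ) : ENNReal :=
  h1Norm a b w + normL a b 2 (dx a b (dx a b w))

/-- The effective potential `G(u) = ∫_α^u f(s) D(s) ds`. -/
def potential (D f : ℝ → ℝ) (α u : ℝ) : ℝ := ∫ s in α..u, f s * D s

/-- The renormalized energy `E_ε[w] = ∫_a^b (ε/2) [D(w) w_x]² + G(w)/ε dx`. -/
def energy (D f : ℝ → ℝ) (α a b ε : ℝ) (w : ℝ → ℝ) : ℝ :=
  ∫ x in a..b, (ε / 2 * (D (w x) * dx a b w x) ^ 2 + potential D f α (w x) / ε)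

/-- The energy `γ₀ = ∫_α^β √(2 G(s)) D(s) ds` of one transition. -/
def gammaZero (D f : ℝ → ℝ) (α β : ℝ) : ℝ :=
  ∫ s in α..β, Real.sqrt (2 * potential D f α s) * D s

/-- `λ = min {f'(α)/D(α), f'(β)/D(β)}`. -/
def lam (D f : ℝ → ℝ) (α β : ℝ) : ℝ := min (deriv f α / D α) (deriv f β / D β)

/-- `v : [a, b] → {α, β}` is piecewise constant, with jumps exactly at the `N` points
`h 0 < h 1 < ⋯ < h (N - 1)`, which are more than `2 r` apart from each other and at least `r`
away from the end points. The values of `v` at the jumps are not prescribed. -/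
structure IsStep (a b α β : ℝ) (N : ℕ) (h : Fin N → ℝ) (r : ℝ) (v : ℝ → ℝ) : Prop where
  r_pos : 0 < r
  gap : ∀ i j : Fin N, i < j → h i + r < h j - r
  left_end : ∀ i, a ≤ h i - r
  right_end : ∀ i, h i + r ≤ b
  values : ∀ x ∈ Icc a b, v x = α ∨ v x = β
  const : ∀ x ∈ Icc a b, ∀ y ∈ Icc a b, x ≤ y → (∀ i, h i ∉ Icc x y) → v x = v y
  jump : ∀ i, ∀ x ∈ Ioo (h i - r) (h i), ∀ y ∈ Ioo (h i) (h i + r), v x ≠ v y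

/-- `u` (written `u t x`) is a global strong solution, with values in `I` and with time
derivative `ut`, of `u_t = ε² (D(u) u_x)_x - f(u)` on `(a, b) × (0, ∞)`,
`u_x(a, t) = u_x(b, t) = 0` for `t > 0`, `u(x, 0) = u₀(x)`. It lies in
`C([0, ∞), H¹(a, b)) ∩ C((0, ∞), H²(a, b))`, is differentiable in time as a map
`(0, ∞) → L²(a, b)`, and satisfies the equation in `L²(a, b)` for each `t > 0`. -/
structure IsSolution (D f : ℝ → ℝ) (I : Set ℝ) (a b ε : ℝ) (u₀ : ℝ → ℝ)
    (u ut : ℝ → ℝ → ℝ) : Prop where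
  mem_I : ∀ t, 0 ≤ t → ∀ x ∈ Icc a b, u t x ∈ I
  memH1 : ∀ t, 0 ≤ t → MemH1 a b (u t)
  memH2 : ∀ t, 0 < t → MemH2 a b (u t)
  contH1 : ∀ t, 0 ≤ t →
    Tendsto (fun s => h1Norm a b (fun x => u s x - u t x)) (𝓝[Ici 0] t) (𝓝 0)
  contH2 : ∀ t, 0 < t → Tendsto (fun s => h2Norm a b (fun x => u s x - u t x)) (𝓝 t) (𝓝 0)
  memL2_ut : ∀ t, 0 < t → MemLp (ut t) 2 (volume.restrict (Ioo a b))
  time_deriv : ∀ t, 0 < t →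
    Tendsto (fun s => normL a b 2 (fun x => (u s x - u t x) / (s - t) - ut t x))
      (𝓝[≠] t) (𝓝 0)
  equation : ∀ t, 0 < t → ∀ᵐ x ∂(volume.restrict (Ioo a b)),
    ut t x = ε ^ 2 * dx a b (fun y => D (u t y) * dx a b (u t) y) x - f (u t x)
  neumann : ∀ t, 0 < t → dx a b (u t) a = 0 ∧ dx a b (u t) b = 0
  initial : ∀ x ∈ Icc a b, u 0 x = u₀ x

end

end AllenCahn

namespace AllenCahn

/-! The equation is a gradient flow: along a solution dE/dt = -ε⁻¹ ∫ D(u) u_t²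
(`hasDerivAt_energy`). Since D ≥ d, the integral of ‖u_t‖² up to time T is at most (ε/d) (E[u(0)] -
E[u(T)]). What is needed is a lower bound for E[u(T)] that matches the initial bound N γ₀ + C
e^{-A/ε} up to a multiple of e^{-A/ε}, for T of order ε⁻¹ e^{A/ε}.

The lower bound (`exists_energy_lower_bound`) holds for every state L¹-close to v and does not use
the equation. With Φ = `cost`, Young's inequality bounds the energy of an interval by the increment
of Φ(w). Alone this is too weak, because near a jump w is only within a fixed distance of the wells.
The defect |Φ(w) - Φ(γ)| at a well γ is recovered from the interval between that point and the end
of the window: Φ(w) - Φ(γ) is weighted by a tanh that vanishes at the far end (`calibration`). This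
weight is admissible at scale ε because √(λ/2) |Φ - Φ(γ)| ≤ G near γ (`IsModel.cost_le_potential`),
and 1 - tanh produces the exponentially small error (`exists_half_layer`).

The solution remains near v by continuation (`norm_sub_le_of_controlled_dissipation`). While u(t) is
in a fixed L² ball about u(0), it is L¹-close to v, so the energy has dropped by at most (C + C')
e^{-A/ε}. The L² distance travelled is then controlled by the square root of time times dissipation,
and the boundary of the ball cannot be reached before a time of order ε⁻¹ e^{A/ε}. -/

/-! ### Absolutely continuous functions and H¹(a, b) -/

theorem absolutelyContinuous_comp_of_lipschitzOnWith {w g : ℝ → ℝ} {a b : ℝ} {s : Set ℝ}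
    {K : NNReal} (hg : LipschitzOnWith K g s) (hw : AbsolutelyContinuousOnInterval w a b)
    (hs : MapsTo w (uIcc a b) s) : AbsolutelyContinuousOnInterval (fun x => g (w x)) a b := by
  rw [absolutelyContinuousOnInterval_iff] at hw ⊢
  intro ε hε
  obtain ⟨δ, hδ, H⟩ := hw (ε / (K + 1)) (by positivity)
  refine ⟨δ, hδ, fun E hE1 hE2 => ?_⟩
  have h1 := H E hE1 hE2
  calc _ ≤ ∑ i ∈ Finset.range E.1, K * dist (w (E.2 i).1) (w (E.2 i).2) := by
        refine Finset.sum_le_sum fun i hi => ?_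
        have := hE1.1 i hi
        exact hg.dist_le_mul _ (hs this.1) _ (hs this.2)
    _ = K * ∑ i ∈ Finset.range E.1, dist (w (E.2 i).1) (w (E.2 i).2) := by rw [Finset.mul_sum]
    _ ≤ K * (ε / (K + 1)) := by gcongr
    _ < ε := by
        rw [mul_div_assoc', div_lt_iff₀ (by positivity)]
        nlinarith [K.coe_nonneg]

/-- A continuous function on `[a, b]` with values in an open interval stays away from its ends. -/
theorem exists_range {I : Set ℝ} (hIo : IsOpen I) (hIc : I.OrdConnected) {a b : ℝ} (hab : a ≤ b)
    {w : ℝ → ℝ} (hw : ContinuousOn w (Icc a b)) (hwI : ∀ x ∈ Icc a b, w x ∈ I) :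
    ∃ m M δ : ℝ, 0 < δ ∧ Icc m M ⊆ I ∧ ∀ x ∈ Icc a b, m + δ ≤ w x ∧ w x + δ ≤ M := by
  obtain ⟨p, hp, hpm⟩ := isCompact_Icc.exists_isMinOn (nonempty_Icc.2 hab) hw
  obtain ⟨q, hq, hqm⟩ := isCompact_Icc.exists_isMaxOn (nonempty_Icc.2 hab) hw
  obtain ⟨δ₁, h1, H1⟩ := Metric.isOpen_iff.1 hIo _ (hwI p hp)
  obtain ⟨δ₂, h2, H2⟩ := Metric.isOpen_iff.1 hIo _ (hwI q hq)
  -- The margin δ on both sides is what later keeps functions uniformly close to `w` inside the same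
  -- compact subinterval of `I`.
  set δ := min δ₁ δ₂ / 2 with hδ
  have hδ0 : 0 < δ := by positivity
  have l1 : δ < δ₁ := by have := min_le_left δ₁ δ₂; have := lt_min h1 h2; linarith
  have l2 : δ < δ₂ := by have := min_le_right δ₁ δ₂; have := lt_min h1 h2; linarith
  refine ⟨w p - δ, w q + δ, δ, hδ0, hIc.out (H1 ?_) (H2 ?_), fun x hx => ⟨?_, ?_⟩⟩
  · simp [abs_of_pos hδ0, l1]
  · simp [abs_of_pos hδ0, l2]
  · have := hpm hx; simp at this; linarith
  · have := hqm hx; simp at this; linarith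

theorem exists_lipschitzOnWith_Icc {g g' : ℝ → ℝ} {m M : ℝ}
    (hg : ∀ u ∈ Icc m M, HasDerivAt g (g' u) u) (hg' : ContinuousOn g' (Icc m M)) :
    ∃ K : NNReal, LipschitzOnWith K g (Icc m M) := by
  obtain ⟨C, hC⟩ := isCompact_Icc.exists_bound_of_continuousOn hg'
  refine ⟨C.toNNReal, (convex_Icc m M).lipschitzOnWith_of_nnnorm_hasDerivWithin_le
    (fun u hu => (hg u hu).hasDerivWithinAt) fun u hu => ?_⟩
  rw [← NNReal.coe_le_coe, coe_nnnorm]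
  exact (hC u hu).trans (Real.le_coe_toNNReal C)

theorem absolutelyContinuous_comp {I : Set ℝ} (hIo : IsOpen I) (hIc : I.OrdConnected) {a b : ℝ}
    (hab : a ≤ b) {w g g' : ℝ → ℝ} (hw : AbsolutelyContinuousOnInterval w a b)
    (hwI : ∀ x ∈ Icc a b, w x ∈ I) (hg : ∀ u ∈ I, HasDerivAt g (g' u) u)
    (hg' : ContinuousOn g' I) : AbsolutelyContinuousOnInterval (fun x => g (w x)) a b := by
  have hwc := hw.continuousOn
  rw [uIcc_of_le hab] at hwc
  obtain ⟨m, M, δ, hδ, hI, H⟩ := exists_range hIo hIc hab hwc hwI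
  obtain ⟨K, hK⟩ := exists_lipschitzOnWith_Icc (fun u hu => hg u (hI hu)) (hg'.mono hI)
  refine absolutelyContinuous_comp_of_lipschitzOnWith hK hw fun x hx => ?_
  rw [uIcc_of_le hab] at hx
  have := H x hx
  exact ⟨by linarith, by linarith⟩

theorem dx_eq_deriv {a b x : ℝ} (w : ℝ → ℝ) (hx : x ∈ Ioo a b) : dx a b w x = deriv w x :=
  derivWithin_of_mem_nhds (Icc_mem_nhds hx.1 hx.2)

theorem ae_hasDerivAt_dx {a b : ℝ} {w : ℝ → ℝ} (hw : AbsolutelyContinuousOnInterval w a b) :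
    ∀ᵐ x ∂volume.restrict (Ioo a b), HasDerivAt w (dx a b w x) x := by
  rw [ae_restrict_iff' measurableSet_Ioo]
  filter_upwards [hw.ae_differentiableAt] with x hx hx'
  rw [dx_eq_deriv w hx']
  exact (hx (Ioo_subset_Icc_self.trans Icc_subset_uIcc hx')).hasDerivAt

/-- Absolute continuity makes an almost everywhere derivative sufficient for the fundamental
theorem, so the integrand may be whatever formula the chain and product rules give off a null set.
-/
theorem integral_eq_sub_of_ae_hasDerivAt {a b x y : ℝ} {F g : ℝ → ℝ}
    (hF : AbsolutelyContinuousOnInterval F a b)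
    (hg : ∀ᵐ z ∂volume.restrict (Ioo a b), HasDerivAt F (g z) z)
    (hax : a ≤ x) (hxy : x ≤ y) (hyb : y ≤ b) : ∫ z in x..y, g z = F y - F x := by
  have h1 : AbsolutelyContinuousOnInterval F x y :=
    hF.mono (uIcc_subset_uIcc (by rw [uIcc_of_le] <;> grind) (by rw [uIcc_of_le] <;> grind))
  rw [← h1.integral_deriv_eq_sub, intervalIntegral.integral_of_le hxy,
    intervalIntegral.integral_of_le hxy, integral_Ioc_eq_integral_Ioo, integral_Ioc_eq_integral_Ioo]
  refine integral_congr_ae ?_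
  filter_upwards [ae_restrict_of_ae_restrict_of_subset (Ioo_subset_Ioo hax hyb) hg] with z hz
  exact hz.deriv.symm

theorem hasDerivAt_primitive {I : Set ℝ} (hIo : IsOpen I) (hIc : I.OrdConnected) {q : ℝ → ℝ}
    (hq : ContinuousOn q I) {c u : ℝ} (hc : c ∈ I) (hu : u ∈ I) :
    HasDerivAt (fun y => ∫ s in c..y, q s) (q u) u := by
  refine intervalIntegral.integral_hasDerivAt_right
    ((hq.mono (hIc.uIcc_subset hc hu)).intervalIntegrable) ?_ (hq.continuousAt (hIo.mem_nhds hu))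
  exact hq.stronglyMeasurableAtFilter hIo _ hu

theorem eLpNorm_bdd_mul_le {a b c : ℝ} {q g : ℝ → ℝ} (hq : ∀ x ∈ Ioo a b, |q x| ≤ c) :
    normL a b 2 (fun x => q x * g x) ≤ ENNReal.ofReal c * normL a b 2 g := by
  refine eLpNorm_le_mul_eLpNorm_of_ae_le_mul ?_ 2
  rw [ae_restrict_iff' measurableSet_Ioo]
  refine Eventually.of_forall fun x hx => ?_
  rw [norm_mul]
  exact mul_le_mul_of_nonneg_right (hq x hx) (norm_nonneg _)

theorem memLp_continuousOn {a b : ℝ} {p : ENNReal} {w : ℝ → ℝ} (hw : ContinuousOn w (Icc a b)) :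
    MemLp w p (volume.restrict (Ioo a b)) := by
  obtain ⟨C, hC⟩ := isCompact_Icc.exists_bound_of_continuousOn hw
  refine MemLp.of_bound
    ((hw.mono Ioo_subset_Icc_self).aestronglyMeasurable measurableSet_Ioo) C ?_
  rw [ae_restrict_iff' measurableSet_Ioo]
  exact Eventually.of_forall fun x hx => hC x (Ioo_subset_Icc_self hx)

theorem memLp_continuousOn_mul {a b : ℝ} {q g : ℝ → ℝ} (hq : ContinuousOn q (Icc a b))
    (hg : MemLp g 2 (volume.restrict (Ioo a b))) :
    MemLp (fun x => q x * g x) 2 (volume.restrict (Ioo a b)) := by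
  obtain ⟨C, hC⟩ := isCompact_Icc.exists_bound_of_continuousOn hq
  refine ⟨((hq.mono Ioo_subset_Icc_self).aestronglyMeasurable measurableSet_Ioo).mul hg.1,
    (eLpNorm_bdd_mul_le (c := C) fun x hx => hC x (Ioo_subset_Icc_self hx)).trans_lt
    (ENNReal.mul_lt_top ENNReal.ofReal_lt_top hg.2)⟩

theorem MemH1.continuousOn {a b : ℝ} (hab : a ≤ b) {w : ℝ → ℝ} (hw : MemH1 a b w) :
    ContinuousOn w (Icc a b) := by
  simpa [uIcc_of_le hab] using hw.1.continuousOn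

/-- Uniform bound of a function by its `H¹` norm. -/
theorem MemH1.abs_mul_le {a b : ℝ} (hab : a < b) {w : ℝ → ℝ} (hw : MemH1 a b w) {x : ℝ}
    (hx : x ∈ Icc a b) :
    ENNReal.ofReal |w x| * ENNReal.ofReal (b - a) ^ (1 / 2 : ℝ) ≤
      (1 + ENNReal.ofReal (b - a)) * h1Norm a b w := by
  set μ := volume.restrict (Ioo a b) with hμ
  have hμu : μ univ = ENNReal.ofReal (b - a) := by simp [hμ]
  have hint : Integrable (dx a b w) μ := hw.2.integrable (by norm_num)
  set c := ∫ z in Ioo a b, |dx a b w z| with hc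
  have hc0 : 0 ≤ c := integral_nonneg fun _ => abs_nonneg _
  -- The L² norm in `y` of this inequality gives the factor (b - a)^{1/2} on the left. A second such
  -- factor comes from bounding the L¹ norm `c` of the derivative by its L² norm.
  have key : ∀ y ∈ Icc a b, |w x| ≤ |w y| + c := by
    have aux : ∀ y ∈ Icc a b, ∀ z ∈ Icc a b, y ≤ z → |w z - w y| ≤ c := by
      intro y hy z hz hyz
      rw [← integral_eq_sub_of_ae_hasDerivAt hw.1 (ae_hasDerivAt_dx hw.1) hy.1 hyz hz.2,
        intervalIntegral.integral_of_le hyz, integral_Ioc_eq_integral_Ioo]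
      refine (abs_integral_le_integral_abs).trans ?_
      exact setIntegral_mono_set hint.abs (Eventually.of_forall fun _ => abs_nonneg _)
        (Ioo_subset_Ioo hy.1 hz.2).eventuallyLE
    intro y hy
    have h1 : |w x - w y| ≤ c := by
      rcases le_total x y with h | h
      · rw [abs_sub_comm]; exact aux x hx y hy h
      · exact aux y hy x hx h
    have := abs_sub_abs_le_abs_sub (w x) (w y)
    linarith
  have hwm : AEStronglyMeasurable w μ := (memLp_continuousOn (p := 2) (hw.continuousOn hab.le)).1
  have h1 : eLpNorm (fun _ : ℝ => |w x|) 2 μ ≤ eLpNorm w 2 μ + eLpNorm (fun _ : ℝ => c) 2 μ := by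
    refine le_trans ?_ ((eLpNorm_add_le hwm.norm aestronglyMeasurable_const
      one_le_two).trans_eq (by rw [eLpNorm_norm]))
    refine eLpNorm_mono_ae_real ?_
    rw [hμ, ae_restrict_iff' measurableSet_Ioo]
    refine Eventually.of_forall fun y hy => ?_
    simpa using key y (Ioo_subset_Icc_self hy)
  have hμ0 : μ ≠ 0 := by
    intro h0
    have : μ univ = 0 := by simp [h0]
    rw [hμu] at this
    simp at this; linarith
  have h2 : ∀ r : ℝ, 0 ≤ r → eLpNorm (fun _ : ℝ => r) 2 μ =
      ENNReal.ofReal r * ENNReal.ofReal (b - a) ^ (1 / 2 : ℝ) := by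
    intro r hr
    rw [eLpNorm_const r (by norm_num) hμ0, hμu, Real.enorm_of_nonneg hr]
    norm_num
  have h3 : ENNReal.ofReal c ≤ eLpNorm (dx a b w) 2 μ * ENNReal.ofReal (b - a) ^ (1 / 2 : ℝ) := by
    have : ENNReal.ofReal c = eLpNorm (dx a b w) 1 μ := by
      rw [eLpNorm_one_eq_lintegral_enorm, hc, ← ofReal_integral_norm_eq_lintegral_enorm hint]
      rfl
    rw [this]
    refine (eLpNorm_le_eLpNorm_mul_rpow_measure_univ (q := 2) (by norm_num) hw.2.1).trans_eq ?_
    rw [hμu, ← hμ]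
    norm_num
  rw [h2 _ (abs_nonneg _), h2 _ hc0] at h1
  have hs : ENNReal.ofReal (b - a) ^ (1 / 2 : ℝ) * ENNReal.ofReal (b - a) ^ (1 / 2 : ℝ) =
      ENNReal.ofReal (b - a) := by
    rw [← ENNReal.rpow_add_of_nonneg _ _ (by norm_num) (by norm_num)]
    norm_num
  refine h1.trans ?_
  unfold h1Norm normL
  calc _ ≤ eLpNorm w 2 μ + eLpNorm (dx a b w) 2 μ * ENNReal.ofReal (b - a) ^ (1 / 2 : ℝ) *
        ENNReal.ofReal (b - a) ^ (1 / 2 : ℝ) := by gcongr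
    _ = eLpNorm w 2 μ + ENNReal.ofReal (b - a) * eLpNorm (dx a b w) 2 μ := by
        rw [mul_assoc, hs, mul_comm]
    _ ≤ 1 * (eLpNorm w 2 μ + eLpNorm (dx a b w) 2 μ) +
        ENNReal.ofReal (b - a) * (eLpNorm w 2 μ + eLpNorm (dx a b w) 2 μ) := by
        rw [one_mul]
        gcongr
        · exact le_self_add
        · exact le_add_self
    _ = _ := by rw [add_mul]

/-- Convergence in `H¹(a, b)` implies uniform convergence. -/
theorem tendsto_unif_of_h1Norm {a b : ℝ} (hab : a < b) {ι : Type*} {l : Filter ι}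
    {w : ι → ℝ → ℝ} (hw : ∀ᶠ i in l, MemH1 a b (w i))
    (h : Tendsto (fun i => h1Norm a b (w i)) l (𝓝 0)) {η : ℝ} (hη : 0 < η) :
    ∀ᶠ i in l, ∀ x ∈ Icc a b, |w i x| < η := by
  have hb : 0 < ENNReal.ofReal (b - a) := by simpa using hab
  have hb' : 0 < ENNReal.ofReal (b - a) ^ (1 / 2 : ℝ) :=
    ENNReal.rpow_pos hb ENNReal.ofReal_ne_top
  have h2 : Tendsto (fun i => (1 + ENNReal.ofReal (b - a)) * h1Norm a b (w i)) l (𝓝 0) := by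
    simpa using ENNReal.Tendsto.const_mul h (Or.inr (by simp))
  have hpos : 0 < ENNReal.ofReal η * ENNReal.ofReal (b - a) ^ (1 / 2 : ℝ) :=
    ENNReal.mul_pos (by simpa using hη) hb'.ne'
  filter_upwards [hw, h2.eventually_lt_const hpos] with i hi hlt x hx
  have h3 := (hi.abs_mul_le hab hx).trans_lt hlt
  by_contra! hcon
  refine absurd h3 (not_lt.2 ?_)
  gcongr

/-! ### The potential G and the transition cost Φ near and away from the wells -/

/-- The standing assumptions on the diffusivity and the reaction term. -/
structure IsModel (D f : ℝ → ℝ) (I : Set ℝ) (d α β : ℝ) : Prop where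
  isOpen : IsOpen I
  ordConn : I.OrdConnected
  lt : α < β
  Icc_subset : Icc α β ⊆ I
  contDiff_D : ContDiffOn ℝ 2 D I
  contDiff_f : ContDiffOn ℝ 2 f I
  d_pos : 0 < d
  le_D : ∀ u ∈ I, d ≤ D u
  f_left : f α = 0
  f_right : f β = 0
  deriv_left : 0 < deriv f α
  deriv_right : 0 < deriv f β
  integral_eq_zero : ∫ s in α..β, f s * D s = 0
  integral_pos : ∀ u ∈ I, u ≠ α → u ≠ β → 0 < ∫ s in α..u, f s * D s

/-- The primitive `∫_α^u √(2 G(s)) D(s) ds` of the transition cost. -/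
noncomputable def cost (D f : ℝ → ℝ) (α u : ℝ) : ℝ :=
  ∫ s in α..u, Real.sqrt (2 * potential D f α s) * D s

theorem hasDerivAt_of_contDiffOn_two {I : Set ℝ} (hI : IsOpen I) {g : ℝ → ℝ}
    (hg : ContDiffOn ℝ 2 g I) {u : ℝ} (hu : u ∈ I) : HasDerivAt g (deriv g u) u :=
  ((hg.differentiableOn (by norm_num)).differentiableAt (hI.mem_nhds hu)).hasDerivAt

theorem continuousOn_deriv_of_contDiffOn_two {I : Set ℝ} (hI : IsOpen I) {g : ℝ → ℝ}
    (hg : ContDiffOn ℝ 2 g I) : ContinuousOn (deriv g) I :=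
  hg.continuousOn_deriv_of_isOpen hI (by norm_num)

/-- A function vanishing at `c` whose derivative has the sign of `u - c` is nonnegative. -/
theorem nonneg_of_deriv_sign {F F' : ℝ → ℝ} {c η : ℝ} (hc : F c = 0)
    (hF : ∀ u, |u - c| < η → HasDerivAt F (F' u) u)
    (hs : ∀ u, |u - c| < η → 0 ≤ F' u * (u - c)) {u : ℝ} (hu : |u - c| < η) : 0 ≤ F u := by
  rcases lt_trichotomy u c with h | h | h
  · have hin : ∀ x ∈ Icc u c, |x - c| < η := by
      intro x hx
      rw [abs_of_nonpos (by linarith [hx.2])]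
      rw [abs_of_neg (by linarith)] at hu
      linarith [hx.1]
    obtain ⟨x, hx, hx'⟩ := exists_hasDerivAt_eq_slope F F' h
      (fun x hx => (hF x (hin x hx)).continuousAt.continuousWithinAt)
      (fun x hx => hF x (hin x (Ioo_subset_Icc_self hx)))
    have h1 := hs x (hin x (Ioo_subset_Icc_self hx))
    have h2 : F' x ≤ 0 := by nlinarith [hx.2]
    rw [hx', hc] at h2
    rw [div_le_iff₀ (by linarith)] at h2
    linarith
  · rw [h, hc]
  · have hin : ∀ x ∈ Icc c u, |x - c| < η := by
      intro x hx
      rw [abs_of_nonneg (by linarith [hx.1])]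
      rw [abs_of_pos (by linarith)] at hu
      linarith [hx.2]
    obtain ⟨x, hx, hx'⟩ := exists_hasDerivAt_eq_slope F F' h
      (fun x hx => (hF x (hin x hx)).continuousAt.continuousWithinAt)
      (fun x hx => hF x (hin x (Ioo_subset_Icc_self hx)))
    have h1 := hs x (hin x (Ioo_subset_Icc_self hx))
    have h2 : 0 ≤ F' x := by nlinarith [hx.1]
    rw [hx', hc] at h2
    rw [le_div_iff₀ (by linarith)] at h2
    linarith

namespace IsModel

variable {D f : ℝ → ℝ} {I : Set ℝ} {d α β : ℝ}

theorem left_mem (H : IsModel D f I d α β) : α ∈ I := H.Icc_subset (left_mem_Icc.2 H.lt.le)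

theorem right_mem (H : IsModel D f I d α β) : β ∈ I := H.Icc_subset (right_mem_Icc.2 H.lt.le)

theorem D_pos (H : IsModel D f I d α β) {u : ℝ} (hu : u ∈ I) : 0 < D u :=
  H.d_pos.trans_le (H.le_D u hu)

theorem hasDerivAt_potential (H : IsModel D f I d α β) {u : ℝ} (hu : u ∈ I) :
    HasDerivAt (potential D f α) (f u * D u) u :=
  hasDerivAt_primitive H.isOpen H.ordConn
    (H.contDiff_f.continuousOn.mul H.contDiff_D.continuousOn) H.left_mem hu

theorem continuousOn_potential (H : IsModel D f I d α β) : ContinuousOn (potential D f α) I :=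
  fun _ hu => (H.hasDerivAt_potential hu).continuousAt.continuousWithinAt

theorem potential_left (D f : ℝ → ℝ) (α : ℝ) : potential D f α α = 0 :=
  intervalIntegral.integral_same

theorem potential_pos (H : IsModel D f I d α β) {u : ℝ} (hu : u ∈ I) (h1 : u ≠ α) (h2 : u ≠ β) :
    0 < potential D f α u := H.integral_pos u hu h1 h2

theorem potential_nonneg (H : IsModel D f I d α β) {u : ℝ} (hu : u ∈ I) :
    0 ≤ potential D f α u := by
  by_cases h1 : u = α
  · rw [h1, potential_left]
  by_cases h2 : u = β
  · rw [h2]; exact H.integral_eq_zero.ge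
  exact (H.potential_pos hu h1 h2).le

theorem continuousOn_costDensity (H : IsModel D f I d α β) :
    ContinuousOn (fun s => Real.sqrt (2 * potential D f α s) * D s) I :=
  ((continuousOn_const.mul H.continuousOn_potential).sqrt).mul H.contDiff_D.continuousOn

theorem hasDerivAt_cost (H : IsModel D f I d α β) {u : ℝ} (hu : u ∈ I) :
    HasDerivAt (cost D f α) (Real.sqrt (2 * potential D f α u) * D u) u :=
  hasDerivAt_primitive H.isOpen H.ordConn H.continuousOn_costDensity H.left_mem hu

theorem monotoneOn_cost (H : IsModel D f I d α β) : MonotoneOn (cost D f α) I := by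
  refine monotoneOn_of_deriv_nonneg H.ordConn.convex
    (fun u hu => (H.hasDerivAt_cost hu).continuousAt.continuousWithinAt) ?_ ?_
  · exact fun u hu =>
      (H.hasDerivAt_cost (interior_subset hu)).differentiableAt.differentiableWithinAt
  · intro u hu
    have hu' := interior_subset hu
    rw [(H.hasDerivAt_cost hu').deriv]
    exact mul_nonneg (Real.sqrt_nonneg _) (H.D_pos hu').le

/-- Φ' = √(2G) D vanishes only at the wells. These may be end points of `[p, q]`, the case needed to
separate Φ(γ) from Φ(γ ± η). -/
theorem strictMonoOn_cost (H : IsModel D f I d α β) {p q : ℝ} (hpq : Icc p q ⊆ I)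
    (h1 : α ∉ Ioo p q) (h2 : β ∉ Ioo p q) : StrictMonoOn (cost D f α) (Icc p q) := by
  refine strictMonoOn_of_deriv_pos (convex_Icc p q)
    (fun u hu => (H.hasDerivAt_cost (hpq hu)).continuousAt.continuousWithinAt) ?_
  intro u hu
  rw [interior_Icc] at hu
  have hu' := hpq (Ioo_subset_Icc_self hu)
  rw [(H.hasDerivAt_cost hu').deriv]
  refine mul_pos (Real.sqrt_pos.2 (mul_pos two_pos (H.potential_pos hu' ?_ ?_))) (H.D_pos hu')
  · rintro rfl; exact h1 hu
  · rintro rfl; exact h2 hu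

theorem cost_left (D f : ℝ → ℝ) (α : ℝ) : cost D f α α = 0 := intervalIntegral.integral_same

theorem lam_pos (H : IsModel D f I d α β) : 0 < lam D f α β :=
  lt_min (div_pos H.deriv_left (H.D_pos H.left_mem)) (div_pos H.deriv_right (H.D_pos H.right_mem))

/-- Near a well the potential controls the transition cost. -/
theorem cost_le_potential (H : IsModel D f I d α β) {γ : ℝ} (hγ : γ = α ∨ γ = β) :
    ∃ η > 0, ∀ u, |u - γ| < η →
      u ∈ I ∧ Real.sqrt (lam D f α β / 2) * |cost D f α u - cost D f α γ| ≤ potential D f α u := by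
  set l := lam D f α β with hl
  have hl0 : 0 < l := H.lam_pos
  have hγI : γ ∈ I := by rcases hγ with rfl | rfl; exacts [H.left_mem, H.right_mem]
  have hfγ : f γ = 0 := by rcases hγ with rfl | rfl; exacts [H.f_left, H.f_right]
  have hGγ : potential D f α γ = 0 := by
    rcases hγ with rfl | rfl; exacts [potential_left _ _ _, H.integral_eq_zero]
  have hf' : 0 < deriv f γ := by rcases hγ with rfl | rfl; exacts [H.deriv_left, H.deriv_right]
  have hlγ : l * D γ ≤ deriv f γ := by
    rw [← le_div_iff₀ (H.D_pos hγI)]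
    rcases hγ with rfl | rfl; exacts [min_le_left _ _, min_le_right _ _]
  have c1 : ContinuousAt (deriv f) γ :=
    (continuousOn_deriv_of_contDiffOn_two H.isOpen H.contDiff_f).continuousAt
      (H.isOpen.mem_nhds hγI)
  have c2 : ContinuousAt (fun u => 2 * deriv f u - l * D u) γ :=
    (c1.const_mul 2).sub ((H.contDiff_D.continuousOn.continuousAt (H.isOpen.mem_nhds hγI)).const_mul l)
  -- At the well itself 2f' - λD ≥ f' > 0 by the choice of λ, so the sign persists nearby. This
  -- slack is why the inequality below holds with no loss in the constant.
  have ev : ∀ᶠ u in 𝓝 γ, u ∈ I ∧ 0 < deriv f u ∧ 0 < 2 * deriv f u - l * D u :=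
    (H.isOpen.mem_nhds hγI |> Filter.eventually_mem_set.2).and
      ((c1.eventually_const_lt hf').and (c2.eventually_const_lt (by linarith)))
  obtain ⟨η, hη, hball⟩ := Metric.eventually_nhds_iff.1 ev
  simp only [Real.dist_eq] at hball
  refine ⟨η, hη, fun u hu => ⟨(hball hu).1, ?_⟩⟩
  have hfd : ∀ u, |u - γ| < η → HasDerivAt f (deriv f u) u := fun u hu =>
    hasDerivAt_of_contDiffOn_two H.isOpen H.contDiff_f (hball hu).1
  have hfs : ∀ u, |u - γ| < η → 0 ≤ f u * (u - γ) := by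
    intro u hu
    refine nonneg_of_deriv_sign (F := fun u => f u * (u - γ)) (c := γ) (η := η)
      (F' := fun u => deriv f u * (u - γ) + f u * 1) (by simp)
      (fun u hu => (hfd u hu).mul ((hasDerivAt_id u).sub_const γ)) ?_ hu
    intro u hu
    have hmon : 0 ≤ f u * (u - γ) := by
      have hS : StrictMonoOn f (Ioo (γ - η) (γ + η)) := by
        refine strictMonoOn_of_deriv_pos (convex_Ioo _ _) (fun x hx => ?_) (fun x hx => ?_)
        · exact (hfd x (by rw [abs_lt]; constructor <;> linarith [hx.1, hx.2])).continuousAt.continuousWithinAt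
        · rw [interior_Ioo] at hx
          exact (hball (by rw [abs_lt]; constructor <;> linarith [hx.1, hx.2])).2.1
      rw [abs_lt] at hu
      have hu1 : u ∈ Ioo (γ - η) (γ + η) := ⟨by linarith, by linarith⟩
      have hg1 : γ ∈ Ioo (γ - η) (γ + η) := ⟨by linarith, by linarith⟩
      rcases le_total u γ with h | h
      · have := hS.monotoneOn hu1 hg1 h
        rw [hfγ] at this
        exact mul_nonneg_of_nonpos_of_nonpos this (by linarith)
      · have := hS.monotoneOn hg1 hu1 h
        rw [hfγ] at this
        exact mul_nonneg this (by linarith)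
    have := (hball hu).2.1
    nlinarith [mul_nonneg this.le (sq_nonneg (u - γ))]
  -- The derivative of f² - λG is f (2f' - λD), which has the sign of u - γ.
  have hJ : ∀ u, |u - γ| < η → 0 ≤ f u ^ 2 - l * potential D f α u := by
    intro u hu
    refine nonneg_of_deriv_sign (F := fun u => f u ^ 2 - l * potential D f α u) (c := γ) (η := η)
      (F' := fun u => f u * (2 * deriv f u - l * D u)) (by simp [hfγ, hGγ]) (fun u hu => ?_) ?_ hu
    · refine (((hfd u hu).pow 2).sub
        ((H.hasDerivAt_potential (hball hu).1).const_mul l)).congr_deriv ?_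
      simp; ring
    · intro u hu
      have := mul_nonneg (hfs u hu) (hball hu).2.2.le
      linarith [this]
  set σ := Real.sqrt (l / 2) with hσ
  have hfσ : ∀ u, |u - γ| < η → σ * Real.sqrt (2 * potential D f α u) ≤ |f u| := by
    intro u hu
    rw [hσ, ← Real.sqrt_mul (by positivity)]
    refine Real.sqrt_le_iff.2 ⟨abs_nonneg _, ?_⟩
    rw [sq_abs]
    linarith [hJ u hu]
  -- The two signs `s` together give the absolute value. The derivative is D (f - s σ √(2G)), and it
  -- has the sign of u - γ because σ √(2G) = √(λG) ≤ |f|.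
  have hmain : ∀ s : ℝ, |s| = 1 →
      0 ≤ potential D f α u - s * (σ * (cost D f α u - cost D f α γ)) := by
    intro s hs
    refine nonneg_of_deriv_sign
      (F := fun u => potential D f α u - s * (σ * (cost D f α u - cost D f α γ))) (c := γ) (η := η)
      (F' := fun u => f u * D u - s * (σ * (Real.sqrt (2 * potential D f α u) * D u)))
      (by simp [hGγ]) (fun u hu => ?_) ?_ hu
    · exact (H.hasDerivAt_potential (hball hu).1).sub
        ((((H.hasDerivAt_cost (hball hu).1).sub_const _).const_mul σ).const_mul s)
    · intro u hu
      have h1 := hfσ u hu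
      have h2 : |f u| * |u - γ| = f u * (u - γ) := by rw [← abs_mul, abs_of_nonneg (hfs u hu)]
      have h3 : s * (u - γ) ≤ |u - γ| := by
        have := le_abs_self (s * (u - γ)); rwa [abs_mul, hs, one_mul] at this
      have h4 : 0 ≤ σ * Real.sqrt (2 * potential D f α u) := by positivity
      have h5 : σ * Real.sqrt (2 * potential D f α u) * (s * (u - γ)) ≤ f u * (u - γ) := by
        rw [← h2]
        exact (mul_le_mul_of_nonneg_left h3 h4).trans (mul_le_mul_of_nonneg_right h1 (abs_nonneg _))
      have := mul_nonneg (sub_nonneg.2 h5) (H.D_pos (hball hu).1).le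
      linarith [this]
  have hp := hmain 1 (by simp)
  have hm := hmain (-1) (by simp)
  have hσ0 : 0 ≤ σ := Real.sqrt_nonneg _
  rw [← abs_of_nonneg hσ0, ← abs_mul, abs_le]
  constructor <;> linarith

end IsModel

/-! ### Lower bounds for the energy of an interval -/

/-- The integrand of the energy. -/
noncomputable def energyDensity (D f : ℝ → ℝ) (α a b ε : ℝ) (w : ℝ → ℝ) (x : ℝ) : ℝ :=
  ε / 2 * (D (w x) * dx a b w x) ^ 2 + potential D f α (w x) / ε

section Energy

variable {D f : ℝ → ℝ} {I : Set ℝ} {d α β a b ε : ℝ} {w : ℝ → ℝ}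

theorem memLp_flux (H : IsModel D f I d α β) (hab : a ≤ b) (hw : MemH1 a b w)
    (hwI : ∀ x ∈ Icc a b, w x ∈ I) :
    MemLp (fun x => D (w x) * dx a b w x) 2 (volume.restrict (Ioo a b)) :=
  memLp_continuousOn_mul (H.contDiff_D.continuousOn.comp (hw.continuousOn hab) hwI) hw.2

theorem integrableOn_energyDensity (H : IsModel D f I d α β) (hab : a ≤ b) (hw : MemH1 a b w)
    (hwI : ∀ x ∈ Icc a b, w x ∈ I) : IntegrableOn (energyDensity D f α a b ε w) (Ioo a b) := by
  refine (((memLp_flux H hab hw hwI).integrable_sq).const_mul _).add ?_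
  exact ((memLp_continuousOn (p := 1) (H.continuousOn_potential.comp (hw.continuousOn hab)
    hwI)).integrable le_rfl).div_const _

theorem energyDensity_nonneg (H : IsModel D f I d α β) (hε : 0 < ε)
    (hwI : ∀ x ∈ Icc a b, w x ∈ I) {x : ℝ} (hx : x ∈ Icc a b) :
    0 ≤ energyDensity D f α a b ε w x := by
  have := H.potential_nonneg (hwI x hx)
  unfold energyDensity
  positivity

/-- Lower bound of the energy of an interval by a calibration. -/
theorem calibration (H : IsModel D f I d α β) (hab : a ≤ b) (hε : 0 < ε) (hw : MemH1 a b w)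
    (hwI : ∀ x ∈ Icc a b, w x ∈ I) (c : ℝ) {τ τ' : ℝ → ℝ} (hτ : ∀ x, HasDerivAt τ (τ' x) x)
    (hτc : Continuous τ') {x y : ℝ} (hax : a ≤ x) (hxy : x ≤ y) (hyb : y ≤ b)
    (hle : ∀ z ∈ Icc x y,
      |cost D f α (w z) - c| * |τ' z| ≤ potential D f α (w z) * (1 - τ z ^ 2) / ε) :
    |(cost D f α (w y) - c) * τ y - (cost D f α (w x) - c) * τ x| ≤
      ∫ z in x..y, energyDensity D f α a b ε w z := by
  have hΦ : AbsolutelyContinuousOnInterval (fun z => cost D f α (w z) - c) a b :=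
    absolutelyContinuous_comp (g := fun u => cost D f α u - c) H.isOpen H.ordConn hab hw.1 hwI
      (fun u hu => (H.hasDerivAt_cost hu).sub_const c) H.continuousOn_costDensity
  have hτac : AbsolutelyContinuousOnInterval τ a b := by
    obtain ⟨K, hK⟩ := exists_lipschitzOnWith_Icc (m := a) (M := b) (fun u _ => hτ u)
      hτc.continuousOn
    exact LipschitzOnWith.absolutelyContinuousOnInterval (K := K) (by rwa [uIcc_of_le hab])
  -- The quantity to bound is the integral of ((Φ(w) - c) τ)'; it suffices to dominate this
  -- derivative pointwise by the energy density.
  have hFTC := integral_eq_sub_of_ae_hasDerivAt (hΦ.fun_mul hτac)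
    (g := fun z => Real.sqrt (2 * potential D f α (w z)) * D (w z) * dx a b w z * τ z +
      (cost D f α (w z) - c) * τ' z) ?_ hax hxy hyb
  · rw [← hFTC, ← Real.norm_eq_abs]
    have hint : IntegrableOn (energyDensity D f α a b ε w) (Ioo x y) :=
      (integrableOn_energyDensity H hab hw hwI).mono_set (Ioo_subset_Ioo hax hyb)
    rw [intervalIntegral.integral_of_le hxy, intervalIntegral.integral_of_le hxy,
      integral_Ioc_eq_integral_Ioo, integral_Ioc_eq_integral_Ioo]
    refine norm_integral_le_of_norm_le hint ?_
    rw [ae_restrict_iff' measurableSet_Ioo]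
    refine Eventually.of_forall fun z hz => ?_
    have hzI := hwI z ⟨hax.trans hz.1.le, hz.2.le.trans hyb⟩
    have hG := H.potential_nonneg hzI
    have hl := hle z (Ioo_subset_Icc_self hz)
    rw [← abs_mul] at hl
    have hsq : Real.sqrt (2 * potential D f α (w z)) ^ 2 = 2 * potential D f α (w z) :=
      Real.sq_sqrt (by positivity)
    set g := Real.sqrt (2 * potential D f α (w z))
    set p := D (w z) * dx a b w z with hp
    -- Young's inequality spends only the fraction τ² of G/ε. The remaining fraction 1 - τ² pays for
    -- the term with τ', by `hle`.
    have h1 : |g * D (w z) * dx a b w z * τ z| ≤ ε / 2 * p ^ 2 + potential D f α (w z) * τ z ^ 2 / ε := by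
      have e1 : g * D (w z) * dx a b w z * τ z = p * (g * τ z) := by rw [hp]; ring
      have e2 : potential D f α (w z) * τ z ^ 2 / ε = (g * τ z) ^ 2 / (2 * ε) := by
        rw [mul_pow, hsq]; field_simp
      rw [e1, e2]
      set q := g * τ z
      have e3 : ε / 2 * p ^ 2 + q ^ 2 / (2 * ε) - |p * q| = (ε * |p| - |q|) ^ 2 / (2 * ε) := by
        rw [abs_mul, ← sq_abs p, ← sq_abs q]; field_simp; ring
      have : 0 ≤ (ε * |p| - |q|) ^ 2 / (2 * ε) := by positivity
      linarith
    rw [Real.norm_eq_abs]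
    refine (abs_add_le _ _).trans ((add_le_add h1 hl).trans_eq ?_)
    unfold energyDensity
    rw [← hp]
    field_simp
    ring
  · have := ae_hasDerivAt_dx hw.1
    filter_upwards [this, ae_restrict_mem measurableSet_Ioo] with z hz hzm
    exact (((H.hasDerivAt_cost (hwI z (Ioo_subset_Icc_self hzm))).comp z hz).sub_const c).mul (hτ z)

/-- The constant weight τ = 1 reduces the calibration to the classical Modica–Mortola estimate. -/
theorem abs_cost_sub_le (H : IsModel D f I d α β) (hab : a ≤ b) (hε : 0 < ε) (hw : MemH1 a b w)
    (hwI : ∀ x ∈ Icc a b, w x ∈ I) {x y : ℝ} (hax : a ≤ x) (hxy : x ≤ y) (hyb : y ≤ b) :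
    |cost D f α (w y) - cost D f α (w x)| ≤ ∫ z in x..y, energyDensity D f α a b ε w z := by
  simpa using calibration H hab hε hw hwI 0 (τ := fun _ => 1) (τ' := fun _ => 0)
    (fun x => hasDerivAt_const x 1) continuous_const hax hxy hyb (by simp)

end Energy

/-! ### Layers: the energy bound with exponentially small error -/

/-- The profile `tanh`, in the form that is convenient for estimates at infinity. -/
noncomputable def profile (s : ℝ) : ℝ := 1 - 2 / (1 + Real.exp (2 * s))

theorem hasDerivAt_profile (s : ℝ) : HasDerivAt profile (1 - profile s ^ 2) s := by
  have h1 : HasDerivAt (fun s : ℝ => 1 + Real.exp (2 * s)) (Real.exp (2 * s) * (2 * 1)) s :=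
    (((hasDerivAt_id s).const_mul 2).exp).const_add 1
  have h0 : (1 + Real.exp (2 * s)) ≠ 0 := by positivity
  refine (((hasDerivAt_const s (2 : ℝ)).div h1 h0).const_sub 1).congr_deriv ?_
  unfold profile
  field_simp
  ring

theorem abs_profile_le (s : ℝ) : |profile s| ≤ 1 := by
  have h0 : 0 < Real.exp (2 * s) := Real.exp_pos _
  have h1 : 2 / (1 + Real.exp (2 * s)) ≤ 2 := by
    rw [div_le_iff₀ (by positivity)]; nlinarith
  have h2 : 0 ≤ 2 / (1 + Real.exp (2 * s)) := by positivity
  rw [abs_le]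
  unfold profile
  constructor <;> linarith

theorem profile_zero : profile 0 = 0 := by norm_num [profile]

theorem le_profile (s : ℝ) : 1 - 2 * Real.exp (-(2 * s)) ≤ profile s := by
  have h0 : 0 < Real.exp (2 * s) := Real.exp_pos _
  have : 2 / (1 + Real.exp (2 * s)) ≤ 2 * Real.exp (-(2 * s)) := by
    rw [Real.exp_neg, ← div_eq_mul_inv]
    gcongr
    linarith
  unfold profile
  linarith

section Layers

variable {D f : ℝ → ℝ} {I : Set ℝ} {d α β a b : ℝ}

/-- Energy of a half layer, up to an exponentially small error. -/
theorem exists_half_layer (H : IsModel D f I d α β) (hab : a ≤ b) {γ : ℝ} (hγ : γ = α ∨ γ = β) :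
    ∃ η > 0, ∃ M > 0, ∀ ε > 0, ∀ w : ℝ → ℝ, MemH1 a b w → (∀ x ∈ Icc a b, w x ∈ I) →
      ∀ x y z : ℝ, a ≤ x → x ≤ y → y ≤ b → (z = x ∨ z = y) → |w z - γ| < η →
      |cost D f α (w z) - cost D f α γ| -
          M * Real.exp (-(Real.sqrt (2 * lam D f α β) * (y - x) / ε)) ≤
        ∫ s in x..y, energyDensity D f α a b ε w s := by
  have hγI : γ ∈ I := by rcases hγ with rfl | rfl; exacts [H.left_mem, H.right_mem]
  obtain ⟨η₁, hη₁, h1⟩ := H.cost_le_potential hγ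
  set σ := Real.sqrt (lam D f α β / 2) with hσ
  have h2σ : 2 * σ = Real.sqrt (2 * lam D f α β) := by
    have : 2 * lam D f α β = 2 ^ 2 * (lam D f α β / 2) := by ring
    rw [this, Real.sqrt_mul (by norm_num), Real.sqrt_sq (by norm_num)]
  have hlt := H.lt
  -- Within η₂ of γ the estimate of Φ by G is available, and the other well is out of reach, so Φ is
  -- strictly monotone on each side of γ.
  set η₂ := min (η₁ / 2) ((β - α) / 2) with hη₂
  have hη₂0 : 0 < η₂ := lt_min (by positivity) (by linarith)
  have hη₂1 : η₂ < η₁ := (min_le_left _ _).trans_lt (by linarith)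
  have hη₂2 : η₂ < β - α := (min_le_right _ _).trans_lt (by linarith)
  have hR : γ + η₂ ∈ I := (h1 _ (by simp [abs_of_pos hη₂0, hη₂1])).1
  have hL : γ - η₂ ∈ I := (h1 _ (by simp [abs_of_pos hη₂0, hη₂1])).1
  have hmR : cost D f α γ < cost D f α (γ + η₂) := by
    refine H.strictMonoOn_cost (H.ordConn.out hγI hR) ?_ ?_ (left_mem_Icc.2 (by linarith))
      (right_mem_Icc.2 (by linarith)) (by linarith)
    · rintro ⟨p, q⟩; rcases hγ with rfl | rfl <;> linarith
    · rintro ⟨p, q⟩; rcases hγ with rfl | rfl <;> linarith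
  have hmL : cost D f α (γ - η₂) < cost D f α γ := by
    refine H.strictMonoOn_cost (H.ordConn.out hL hγI) ?_ ?_ (left_mem_Icc.2 (by linarith))
      (right_mem_Icc.2 (by linarith)) (by linarith)
    · rintro ⟨p, q⟩; rcases hγ with rfl | rfl <;> linarith
    · rintro ⟨p, q⟩; rcases hγ with rfl | rfl <;> linarith
  set m := min (cost D f α (γ + η₂) - cost D f α γ) (cost D f α γ - cost D f α (γ - η₂)) with hm
  have hm0 : 0 < m := lt_min (by linarith) (by linarith)
  have hfar : ∀ u ∈ I, η₂ ≤ |u - γ| → m ≤ |cost D f α u - cost D f α γ| := by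
    intro u hu hu'
    rcases le_abs'.1 hu' with h | h
    · have := H.monotoneOn_cost hu hL (by linarith)
      have := min_le_right (cost D f α (γ + η₂) - cost D f α γ) (cost D f α γ - cost D f α (γ - η₂))
      rw [abs_sub_comm]
      refine le_trans ?_ (le_abs_self _)
      linarith
    · have := H.monotoneOn_cost hR hu (by linarith)
      have := min_le_left (cost D f α (γ + η₂) - cost D f α γ) (cost D f α γ - cost D f α (γ - η₂))
      refine le_trans ?_ (le_abs_self _)
      linarith
  have hcont := (H.hasDerivAt_cost hγI).continuousAt
  -- The value m/2 serves both cases below. If `w` leaves the η₂-neighbourhood, the increment of Φ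
  -- is at least m - m/2, which already exceeds the claim. If it stays, m/2 absorbs the factor 2 of
  -- `le_profile`.
  obtain ⟨η, hη, h2⟩ := Metric.continuousAt_iff.1 hcont (m / 2) (by positivity)
  simp only [Real.dist_eq] at h2
  refine ⟨η, hη, m, hm0, fun ε hε w hw hwI x y z hax hxy hyb hz hzη => ?_⟩
  have hzm := h2 hzη
  have hexp0 := Real.exp_pos (-(Real.sqrt (2 * lam D f α β) * (y - x) / ε))
  by_cases hex : ∃ s ∈ Icc x y, η₂ ≤ |w s - γ|
  · obtain ⟨s, hs, hsη⟩ := hex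
    have hsm := hfar _ (hwI s ⟨hax.trans hs.1, hs.2.trans hyb⟩) hsη
    have hE : |cost D f α (w s) - cost D f α (w z)| ≤
        ∫ s in x..y, energyDensity D f α a b ε w s := by
      have hii : ∀ p q, a ≤ p → p ≤ q → q ≤ b →
          IntervalIntegrable (energyDensity D f α a b ε w) volume p q := by
        intro p q hp hpq hq
        rw [intervalIntegrable_iff_integrableOn_Ioo_of_le hpq]
        exact (integrableOn_energyDensity H hab hw hwI).mono_set (Ioo_subset_Ioo hp hq)
      have hnn : ∀ p q, a ≤ p → p ≤ q → q ≤ b →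
          0 ≤ ∫ s in p..q, energyDensity D f α a b ε w s := fun p q hp hpq hq =>
        intervalIntegral.integral_nonneg hpq fun u hu =>
          energyDensity_nonneg H hε hwI ⟨hp.trans hu.1, hu.2.trans hq⟩
      have hxs : a ≤ s := hax.trans hs.1
      have hsb : s ≤ b := hs.2.trans hyb
      rw [← intervalIntegral.integral_add_adjacent_intervals (hii x s hax hs.1 hsb)
        (hii s y hxs hs.2 hyb)]
      have n1 := hnn x s hax hs.1 hsb
      have n2 := hnn s y hxs hs.2 hyb
      rcases hz with rfl | rfl
      · have := abs_cost_sub_le H hab hε hw hwI hax hs.1 hsb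
        linarith
      · have := abs_cost_sub_le H hab hε hw hwI hxs hs.2 hyb
        rw [abs_sub_comm]
        linarith
    have htri := abs_sub_le (cost D f α (w s)) (cost D f α (w z)) (cost D f α γ)
    have := mul_pos hm0 hexp0
    linarith
  · push Not at hex
    -- `s₀` will be the end opposite to `z`: the tanh vanishes there, so the unknown value of `w` at
    -- that end drops out. The sign of κ makes the tanh positive at `z`.
    have hcal : ∀ κ s₀ : ℝ, |κ| = σ / ε →
        |(cost D f α (w y) - cost D f α γ) * profile (κ * (y - s₀)) -
          (cost D f α (w x) - cost D f α γ) * profile (κ * (x - s₀))| ≤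
        ∫ s in x..y, energyDensity D f α a b ε w s := by
      intro κ s₀ hκ
      have hd : ∀ s, HasDerivAt (fun s => profile (κ * (s - s₀)))
          ((1 - profile (κ * (s - s₀)) ^ 2) * (κ * 1)) s := fun s =>
        (hasDerivAt_profile _).comp s (((hasDerivAt_id s).sub_const s₀).const_mul κ)
      have hpc : Continuous profile :=
        continuous_iff_continuousAt.2 fun s => (hasDerivAt_profile s).continuousAt
      refine calibration H hab hε hw hwI _ hd ?_ hax hxy hyb fun s hs => ?_
      · exact (continuous_const.sub ((hpc.comp (by fun_prop)).pow 2)).mul continuous_const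
      have hG := (h1 (w s) ((hex s hs).trans hη₂1)).2
      have hp : 0 ≤ 1 - profile (κ * (s - s₀)) ^ 2 := by
        have := (sq_le_one_iff_abs_le_one _).2 (abs_profile_le (κ * (s - s₀)))
        linarith
      rw [mul_one, abs_mul, abs_of_nonneg hp, hκ]
      calc _ = (σ * |cost D f α (w s) - cost D f α γ|) *
            (1 - profile (κ * (s - s₀)) ^ 2) / ε := by ring
        _ ≤ _ := by gcongr
    have hfin : ∀ c p E : ℝ, |c| < m / 2 →
        1 - 2 * Real.exp (-(Real.sqrt (2 * lam D f α β) * (y - x) / ε)) ≤ p → |c * p| ≤ E →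
        |c| - m * Real.exp (-(Real.sqrt (2 * lam D f α β) * (y - x) / ε)) ≤ E := by
      intro c p E hc hp hE
      set e := Real.exp (-(Real.sqrt (2 * lam D f α β) * (y - x) / ε))
      have h3 : |c| * p ≤ |c * p| := by
        rw [abs_mul]; exact mul_le_mul_of_nonneg_left (le_abs_self _) (abs_nonneg _)
      nlinarith [abs_nonneg c, mul_le_mul_of_nonneg_left hp (abs_nonneg c)]
    have hσε : |σ / ε| = σ / ε := abs_of_nonneg (by positivity)
    have hrate : 2 * (σ / ε * (y - x)) = Real.sqrt (2 * lam D f α β) * (y - x) / ε := by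
      rw [← h2σ]; ring
    have hprof := le_profile (σ / ε * (y - x))
    rw [hrate] at hprof
    rcases hz with rfl | rfl
    · have := hcal (-(σ / ε)) y (by rw [abs_neg, hσε])
      rw [sub_self, mul_zero, profile_zero, mul_zero, zero_sub, abs_neg,
        show -(σ / ε) * (z - y) = σ / ε * (y - z) by ring] at this
      exact hfin _ _ _ hzm hprof this
    · have := hcal (σ / ε) x hσε
      rw [sub_self, mul_zero, profile_zero, mul_zero, sub_zero] at this
      exact hfin _ _ _ hzm hprof this

/-- A Chebyshev argument, written with lower integrals so that `g`, which will contain the step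
function, need not be measurable. -/
theorem exists_abs_lt_of_normL_one_lt {p q η : ℝ} {g : ℝ → ℝ} (hap : a ≤ p)
    (hqb : q ≤ b) (hη : 0 ≤ η) (h : normL a b 1 g < ENNReal.ofReal (η * (q - p))) :
    ∃ x ∈ Ioo p q, |g x| < η := by
  by_contra! hcon
  refine absurd h (not_lt.2 ?_)
  rw [normL, eLpNorm_one_eq_lintegral_enorm]
  calc ENNReal.ofReal (η * (q - p)) = ∫⁻ _ in Ioo p q, ENNReal.ofReal η := by
        rw [setLIntegral_const, Real.volume_Ioo, ENNReal.ofReal_mul hη]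
    _ ≤ ∫⁻ x in Ioo p q, ‖g x‖ₑ := by
        refine setLIntegral_mono' measurableSet_Ioo fun x hx => ?_
        rw [← ofReal_norm]
        exact ENNReal.ofReal_le_ofReal (hcon x hx)
    _ ≤ _ := lintegral_mono_set (Ioo_subset_Ioo hap hqb)

/-- Lower bound of the energy near a step function: up to an exponentially small error, each of
the `N` layers costs at least `γ₀`. -/
theorem exists_energy_lower_bound (H : IsModel D f I d α β) (hab : a < b) {N : ℕ} {h : Fin N → ℝ}
    {r : ℝ} {v : ℝ → ℝ} (hv : IsStep a b α β N h r v) {A : ℝ} (hA : 0 < A)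
    (hA' : A < r * Real.sqrt (2 * lam D f α β)) :
    ∃ δ > 0, ∃ C > 0, ∀ ε > 0, ∀ w : ℝ → ℝ, MemH1 a b w → (∀ x ∈ Icc a b, w x ∈ I) →
      normL a b 1 (fun x => w x - v x) < ENNReal.ofReal δ →
      N * gammaZero D f α β - C * Real.exp (-A / ε) ≤ energy D f α a b ε w := by
  obtain ⟨ηα, hηα, Mα, hMα, hα⟩ := exists_half_layer H hab.le (γ := α) (Or.inl rfl)
  obtain ⟨ηβ, hηβ, Mβ, hMβ, hβ⟩ := exists_half_layer H hab.le (γ := β) (Or.inr rfl)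
  set S := Real.sqrt (2 * lam D f α β) with hS
  have hr := hv.r_pos
  have hS0 : 0 < S := by
    refine Real.sqrt_pos.2 (mul_pos two_pos H.lam_pos)
  -- Good points are sought within ρ of each jump. This leaves at least r - ρ = A/S for each half
  -- layer, whose error is then at most a multiple of e^{-A/ε}.
  set ρ := r - A / S with hρ
  have hρ0 : 0 < ρ := by rw [hρ, sub_pos, div_lt_iff₀ hS0]; exact hA'
  have hρr : ρ < r := by have : 0 < A / S := by positivity
                         linarith
  have hSr : S * (r - ρ) = A := by rw [hρ]; field_simp; ring
  set η := min ηα ηβ with hη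
  have hη0 : 0 < η := lt_min hηα hηβ
  set M := Mα + Mβ with hM
  -- An L¹ distance below ηρ forces a point with |w - v| < η in every interval of length ρ. The
  -- summand 1 only keeps the constant positive when N = 0.
  refine ⟨η * ρ, by positivity, N * M + 1, by positivity, fun ε hε w hw hwI hwv => ?_⟩
  have hint := integrableOn_energyDensity (ε := ε) H hab.le hw hwI
  set e := energyDensity D f α a b ε w with he
  have hii : ∀ p q, a ≤ p → p ≤ q → q ≤ b → IntervalIntegrable e volume p q := by
    intro p q hp hpq hq
    rw [intervalIntegrable_iff_integrableOn_Ioo_of_le hpq]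
    exact hint.mono_set (Ioo_subset_Ioo hp hq)
  have hlayer : ∀ i, gammaZero D f α β - M * Real.exp (-A / ε) ≤
      ∫ x in Ioo (h i - r) (h i + r), e x := by
    intro i
    have hl := hv.left_end i
    have hr' := hv.right_end i
    obtain ⟨x₀, hx₀, hx₀η⟩ := exists_abs_lt_of_normL_one_lt (a := a) (b := b) (p := h i - ρ)
      (q := h i) (by linarith) (by linarith) hη0.le (by convert! hwv using 3; ring)
    obtain ⟨x₁, hx₁, hx₁η⟩ := exists_abs_lt_of_normL_one_lt (a := a) (b := b) (p := h i)
      (q := h i + ρ) (by linarith) (by linarith) hη0.le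
      (by convert! hwv using 3; ring)
    have hne := hv.jump i x₀ ⟨by linarith [hx₀.1], hx₀.2⟩ x₁ ⟨hx₁.1, by linarith [hx₁.2]⟩
    have a0 : h i - r ≤ x₀ := by linarith [hx₀.1]
    have a1 : x₀ ≤ x₁ := by linarith [hx₀.2, hx₁.1]
    have a2 : x₁ ≤ h i + r := by linarith [hx₁.2]
    have hmid := abs_cost_sub_le H hab.le hε hw hwI (hl.trans a0) a1 (a2.trans hr')
    have hexp : ∀ L, r - ρ ≤ L → Real.exp (-(S * L / ε)) ≤ Real.exp (-A / ε) := by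
      intro L hL
      rw [neg_div, ← hSr]
      gcongr
    have b0 := hexp (x₀ - (h i - r)) (by linarith [hx₀.1])
    have b1 := hexp (h i + r - x₁) (by linarith [hx₁.2])
    have v0 := hv.values x₀ ⟨by linarith, by linarith⟩
    have v1 := hv.values x₁ ⟨by linarith, by linarith⟩
    have hsplit : ∫ x in Ioo (h i - r) (h i + r), e x =
        (∫ x in (h i - r)..x₀, e x) + (∫ x in x₀..x₁, e x) + ∫ x in x₁..(h i + r), e x := by
      rw [intervalIntegral.integral_add_adjacent_intervals
        (hii _ _ hl a0 (by linarith)) (hii _ _ (by linarith) a1 (by linarith)),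
        intervalIntegral.integral_add_adjacent_intervals
        (hii _ _ hl (by linarith) (by linarith)) (hii _ _ (by linarith) a2 (by linarith)),
        intervalIntegral.integral_of_le (by linarith), integral_Ioc_eq_integral_Ioo]
    rw [hsplit]
    have g0 : gammaZero D f α β = cost D f α β - cost D f α α := by
      rw [IsModel.cost_left, sub_zero]; rfl
    have hηα' : η ≤ ηα := min_le_left _ _
    have hηβ' : η ≤ ηβ := min_le_right _ _
    -- The defects |Φ(w) - Φ(γ)| at the two good points complete the increment of Φ between them to
    -- |Φ(β) - Φ(α)| = γ₀, by the triangle inequality. Equal values of `v` contradict the jump.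
    rcases v0 with v0 | v0 <;> rcases v1 with v1 | v1
    · exact absurd (v0.trans v1.symm) hne
    · rw [v0] at hx₀η
      rw [v1] at hx₁η
      have t0 := hα ε hε w hw hwI _ _ x₀ hl a0 (by linarith) (Or.inr rfl) (by linarith)
      have t1 := hβ ε hε w hw hwI _ _ x₁ (by linarith) a2 hr' (Or.inl rfl) (by linarith)
      have u0 := le_abs_self (cost D f α (w x₀) - cost D f α α)
      have u1 := neg_abs_le (cost D f α (w x₁) - cost D f α β)
      have u2 := le_abs_self (cost D f α (w x₁) - cost D f α (w x₀))
      have c0 := mul_le_mul_of_nonneg_left b0 hMα.le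
      have c1 := mul_le_mul_of_nonneg_left b1 hMβ.le
      rw [hM, add_mul]
      linarith
    · rw [v0] at hx₀η
      rw [v1] at hx₁η
      have t0 := hβ ε hε w hw hwI _ _ x₀ hl a0 (by linarith) (Or.inr rfl) (by linarith)
      have t1 := hα ε hε w hw hwI _ _ x₁ (by linarith) a2 hr' (Or.inl rfl) (by linarith)
      have u0 := le_abs_self (cost D f α (w x₁) - cost D f α α)
      have u1 := neg_abs_le (cost D f α (w x₀) - cost D f α β)
      have u2 := neg_abs_le (cost D f α (w x₁) - cost D f α (w x₀))
      have c0 := mul_le_mul_of_nonneg_left b0 hMβ.le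
      have c1 := mul_le_mul_of_nonneg_left b1 hMα.le
      rw [hM, add_mul]
      linarith
    · exact absurd (v0.trans v1.symm) hne
  have hE : energy D f α a b ε w = ∫ x in Ioo a b, e x := by
    rw [energy, intervalIntegral.integral_of_le hab.le, integral_Ioc_eq_integral_Ioo]
    rfl
  have hsub : ∀ i, Ioo (h i - r) (h i + r) ⊆ Ioo a b := fun i =>
    Ioo_subset_Ioo (hv.left_end i) (hv.right_end i)
  have hdisj : Pairwise (Function.onFun Disjoint fun i => Ioo (h i - r) (h i + r)) := by
    intro i j hij
    rw [Function.onFun, Set.disjoint_left]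
    intro x hx hx'
    rcases lt_or_gt_of_ne hij with g | g
    · have := hv.gap i j g; linarith [hx.2, hx'.1]
    · have := hv.gap j i g; linarith [hx.1, hx'.2]
  have hsum : ∑ i, ∫ x in Ioo (h i - r) (h i + r), e x ≤ energy D f α a b ε w := by
    rw [hE, ← integral_iUnion_fintype (fun i => measurableSet_Ioo) hdisj
      (fun i => hint.mono_set (hsub i))]
    refine setIntegral_mono_set hint ?_ (iUnion_subset hsub).eventuallyLE
    rw [EventuallyLE, ae_restrict_iff' measurableSet_Ioo]
    exact Eventually.of_forall fun x hx =>
      energyDensity_nonneg H hε hwI (Ioo_subset_Icc_self hx)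
  have hcard : ∑ _i : Fin N, (gammaZero D f α β - M * Real.exp (-A / ε)) =
      N * (gammaZero D f α β - M * Real.exp (-A / ε)) := by simp [mul_sub]
  have := (Finset.sum_le_sum fun i (_ : i ∈ Finset.univ) => hlayer i).trans hsum
  rw [hcard] at this
  have hpos := Real.exp_pos (-A / ε)
  linarith

end Layers

/-! ### Calculus of L² convergence -/

/-- Convergence in `L²(a, b)`. -/
def TendstoL2 {ι : Type*} (a b : ℝ) (F : ι → ℝ → ℝ) (l : Filter ι) (g : ℝ → ℝ) : Prop :=
  Tendsto (fun s => normL a b 2 (fun x => F s x - g x)) l (𝓝 0)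

section L2

variable {ι : Type*} {l : Filter ι} {a b : ℝ}

theorem TendstoL2.congr' {F F' : ι → ℝ → ℝ} {g g' : ℝ → ℝ} (h : TendstoL2 a b F l g)
    (hF : ∀ᶠ s in l, F s =ᵐ[volume.restrict (Ioo a b)] F' s)
    (hg : g =ᵐ[volume.restrict (Ioo a b)] g') : TendstoL2 a b F' l g' := by
  refine Tendsto.congr' ?_ h
  filter_upwards [hF] with s hs
  refine eLpNorm_congr_ae ?_
  filter_upwards [hs, hg] with x h1 h2
  rw [h1, h2]

theorem tendstoL2_const (g : ℝ → ℝ) : TendstoL2 a b (fun _ : ι => g) l g := by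
  simpa [TendstoL2, normL] using tendsto_const_nhds

theorem TendstoL2.add {F F' : ι → ℝ → ℝ} {g g' : ℝ → ℝ} (h : TendstoL2 a b F l g)
    (h' : TendstoL2 a b F' l g')
    (hF : ∀ᶠ s in l, MemLp (F s) 2 (volume.restrict (Ioo a b)))
    (hF' : ∀ᶠ s in l, MemLp (F' s) 2 (volume.restrict (Ioo a b)))
    (hg : MemLp g 2 (volume.restrict (Ioo a b))) (hg' : MemLp g' 2 (volume.restrict (Ioo a b))) :
    TendstoL2 a b (fun s x => F s x + F' s x) l (fun x => g x + g' x) := by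
  have h0 := Tendsto.add h h'
  rw [add_zero] at h0
  refine tendsto_of_tendsto_of_tendsto_of_le_of_le' tendsto_const_nhds h0
    (Eventually.of_forall fun _ => zero_le) ?_
  filter_upwards [hF, hF'] with s hs hs'
  refine le_trans (le_of_eq ?_) (eLpNorm_add_le (hs.1.sub hg.1) (hs'.1.sub hg'.1) one_le_two)
  refine congrArg (fun k => eLpNorm k 2 _) (funext fun x => ?_)
  simp only [Pi.add_apply]
  ring

/-- Products of uniformly convergent and `L²` convergent functions. -/
theorem TendstoL2.bdd_mul {Q F : ι → ℝ → ℝ} {q g : ℝ → ℝ}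
    (hQ : TendstoUniformlyOn Q q l (Icc a b)) {C : ℝ} (hC : ∀ x ∈ Icc a b, |q x| ≤ C)
    (h : TendstoL2 a b F l g) (hF : ∀ᶠ s in l, MemLp (F s) 2 (volume.restrict (Ioo a b)))
    (hg : MemLp g 2 (volume.restrict (Ioo a b))) :
    TendstoL2 a b (fun s x => Q s x * F s x) l (fun x => q x * g x) := by
  rw [TendstoL2, ENNReal.tendsto_nhds_zero]
  intro κ hκ
  rw [Metric.tendstoUniformlyOn_iff] at hQ
  set B := eLpNorm g 2 (volume.restrict (Ioo a b)) with hB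
  have hB' : B ≠ ⊤ := hg.2.ne
  have hκ2 : 0 < κ / 2 := ENNReal.half_pos hκ.ne'
  -- The error is Q (F - g) + (Q - q) g. This η makes the second term at most κ/2; the first is
  -- small because |Q| ≤ C + η eventually.
  obtain ⟨η, hη, hηB⟩ : ∃ η : ℝ, 0 < η ∧ ENNReal.ofReal η * B ≤ κ / 2 := by
    have ht : Tendsto (fun η : ℝ => ENNReal.ofReal η * B) (𝓝[>] 0) (𝓝 0) := by
      have : Tendsto (fun η : ℝ => ENNReal.ofReal η) (𝓝[>] 0) (𝓝 0) := by
        simpa using (ENNReal.tendsto_ofReal (tendsto_id (α := ℝ) (x := 𝓝 0))).mono_left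
          nhdsWithin_le_nhds
      simpa using ENNReal.Tendsto.mul_const this (Or.inr hB')
    obtain ⟨η, h1, h2⟩ := ((ENNReal.tendsto_nhds_zero.1 ht _ hκ2).and self_mem_nhdsWithin).exists
    exact ⟨η, h2, h1⟩
  have h1 : Tendsto (fun s => ENNReal.ofReal (C + η) * normL a b 2 (fun x => F s x - g x)) l
      (𝓝 0) := by
    simpa using ENNReal.Tendsto.const_mul h (Or.inr ENNReal.ofReal_ne_top)
  filter_upwards [hQ η hη, hF, ENNReal.tendsto_nhds_zero.1 h1 _ hκ2] with s hs hFs hle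
  have hpt : ∀ x ∈ Ioo a b, ‖Q s x * F s x - q x * g x‖ ≤
      |(C + η) * (F s x - g x)| + |η * g x| := by
    intro x hx
    have e1 := hs x (Ioo_subset_Icc_self hx)
    rw [Real.dist_eq, abs_sub_comm] at e1
    have e2 := hC x (Ioo_subset_Icc_self hx)
    have e3 : |Q s x| ≤ C + η := by
      have := abs_sub_abs_le_abs_sub (Q s x) (q x); linarith
    have e4 : Q s x * F s x - q x * g x = Q s x * (F s x - g x) + (Q s x - q x) * g x := by ring
    rw [e4, Real.norm_eq_abs]
    refine (abs_add_le _ _).trans (add_le_add ?_ ?_)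
    · rw [abs_mul, abs_mul]
      exact mul_le_mul_of_nonneg_right (e3.trans (le_abs_self _)) (abs_nonneg _)
    · rw [abs_mul, abs_mul]
      exact mul_le_mul_of_nonneg_right (e1.le.trans (le_abs_self _)) (abs_nonneg _)
  have hm1 : AEStronglyMeasurable (fun x => (C + η) * (F s x - g x))
    (volume.restrict (Ioo a b)) := (hFs.1.sub hg.1).const_mul _
  have hm2 : AEStronglyMeasurable (fun x => η * g x) (volume.restrict (Ioo a b)) :=
    hg.1.const_mul _
  have hCη : ∀ x ∈ Ioo a b, |C + η| ≤ C + η := fun x hx =>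
    (abs_of_nonneg (by linarith [(abs_nonneg _).trans (hC x (Ioo_subset_Icc_self hx))])).le
  calc normL a b 2 (fun x => Q s x * F s x - q x * g x)
      ≤ eLpNorm ((fun x => |(C + η) * (F s x - g x)|) + fun x => |η * g x|) 2
          (volume.restrict (Ioo a b)) := by
        refine eLpNorm_mono_ae_real ?_
        rw [ae_restrict_iff' measurableSet_Ioo]
        exact Eventually.of_forall hpt
    _ ≤ normL a b 2 (fun x => (C + η) * (F s x - g x)) + normL a b 2 (fun x => η * g x) := by
        refine (eLpNorm_add_le hm1.norm hm2.norm one_le_two).trans_eq ?_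
        exact congrArg₂ _ (eLpNorm_norm _) (eLpNorm_norm _)
    _ ≤ ENNReal.ofReal (C + η) * normL a b 2 (fun x => F s x - g x) +
          ENNReal.ofReal η * B := by
        refine add_le_add ?_ ?_
        · exact eLpNorm_bdd_mul_le hCη
        · exact eLpNorm_bdd_mul_le fun _ _ => (abs_of_pos hη).le
    _ ≤ κ / 2 + κ / 2 := add_le_add hle hηB
    _ = κ := ENNReal.add_halves κ

theorem eLpNorm_mul_le_mul {μ : Measure ℝ} {p q : ℝ → ℝ} (hp : AEStronglyMeasurable p μ)
    (hq : AEStronglyMeasurable q μ) :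
    eLpNorm (fun x => p x * q x) 1 μ ≤ eLpNorm p 2 μ * eLpNorm q 2 μ :=
  eLpNorm_le_eLpNorm_mul_eLpNorm'_of_norm (p := 2) (q := 2) hp hq (fun x y : ℝ => x * y) 1 (by simp)
    |>.trans_eq (by simp)

/-- Expand p p' - q q' = (p - q)(p' - q') + (p - q) q' + q (p' - q') and apply Hölder. Apart from
differences only the limits `q`, `q'` occur, so no uniform bound on the approximating families is
needed. -/
theorem eLpNorm_mul_sub_mul_le {μ : Measure ℝ} {p p' q q' : ℝ → ℝ} (hp : AEStronglyMeasurable p μ)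
    (hp' : AEStronglyMeasurable p' μ) (hq : AEStronglyMeasurable q μ)
    (hq' : AEStronglyMeasurable q' μ) :
    eLpNorm ((fun x => p x * p' x) - fun x => q x * q' x) 1 μ ≤
      eLpNorm (fun x => p x - q x) 2 μ * eLpNorm (fun x => p' x - q' x) 2 μ +
        eLpNorm (fun x => p x - q x) 2 μ * eLpNorm q' 2 μ +
      eLpNorm q 2 μ * eLpNorm (fun x => p' x - q' x) 2 μ := by
  have m1 : AEStronglyMeasurable (fun x => p x - q x) μ := hp.sub hq
  have m2 : AEStronglyMeasurable (fun x => p' x - q' x) μ := hp'.sub hq'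
  have e : ((fun x => p x * p' x) - fun x => q x * q' x) =
      ((fun x => (p x - q x) * (p' x - q' x)) + fun x => (p x - q x) * q' x) +
        fun x => q x * (p' x - q' x) := by
    funext x
    simp only [Pi.add_apply, Pi.sub_apply]
    ring
  rw [e]
  refine (eLpNorm_add_le ((m1.mul m2).add (m1.mul hq')) (hq.mul m2) le_rfl).trans ?_
  refine add_le_add ((eLpNorm_add_le (m1.mul m2) (m1.mul hq') le_rfl).trans ?_)
    (eLpNorm_mul_le_mul hq m2)
  exact add_le_add (eLpNorm_mul_le_mul m1 m2) (eLpNorm_mul_le_mul m1 hq')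

theorem tendsto_integral_mul_of_tendstoL2 {F F' : ι → ℝ → ℝ} {g g' : ℝ → ℝ}
    (h : TendstoL2 a b F l g) (h' : TendstoL2 a b F' l g')
    (hF : ∀ᶠ s in l, MemLp (F s) 2 (volume.restrict (Ioo a b)))
    (hF' : ∀ᶠ s in l, MemLp (F' s) 2 (volume.restrict (Ioo a b)))
    (hg : MemLp g 2 (volume.restrict (Ioo a b))) (hg' : MemLp g' 2 (volume.restrict (Ioo a b))) :
    Tendsto (fun s => ∫ x in Ioo a b, F s x * F' s x) l (𝓝 (∫ x in Ioo a b, g x * g' x)) := by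
  have hlim : Tendsto (fun s => normL a b 2 (fun x => F s x - g x) *
        normL a b 2 (fun x => F' s x - g' x) +
      normL a b 2 (fun x => F s x - g x) * normL a b 2 g' +
      normL a b 2 g * normL a b 2 (fun x => F' s x - g' x)) l (𝓝 0) := by
    have t1 := ENNReal.Tendsto.mul h (Or.inr ENNReal.zero_ne_top) h' (Or.inr ENNReal.zero_ne_top)
    have t2 := ENNReal.Tendsto.mul_const (b := normL a b 2 g') h (Or.inr hg'.2.ne)
    have t3 := ENNReal.Tendsto.const_mul (a := normL a b 2 g) h' (Or.inr hg.2.ne)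
    have t4 := (t1.add t2).add t3
    rwa [mul_zero, zero_mul, mul_zero, add_zero, add_zero] at t4
  refine tendsto_integral_of_L1' (fun x => g x * g' x)
    (hg.integrable_mul hg').aestronglyMeasurable ?_ ?_
  · filter_upwards [hF, hF'] with s hs hs'
    exact hs.integrable_mul hs'
  refine tendsto_of_tendsto_of_tendsto_of_le_of_le' tendsto_const_nhds hlim
    (Eventually.of_forall fun _ => zero_le) ?_
  filter_upwards [hF, hF'] with s hs hs'
  exact eLpNorm_mul_sub_mul_le hs.1 hs'.1 hg.1 hg'.1

/-- Composition of a uniformly convergent family with a continuous function. -/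
theorem tendstoUniformlyOn_comp {I : Set ℝ} (hIo : IsOpen I) (hIc : I.OrdConnected) (hab : a ≤ b)
    {F : ι → ℝ → ℝ} {g q : ℝ → ℝ} (hF : TendstoUniformlyOn F g l (Icc a b))
    (hg : ContinuousOn g (Icc a b)) (hgI : ∀ x ∈ Icc a b, g x ∈ I) (hq : ContinuousOn q I) :
    TendstoUniformlyOn (fun s x => q (F s x)) (fun x => q (g x)) l (Icc a b) := by
  obtain ⟨m, M, δ, hδ, hI, hr⟩ := exists_range hIo hIc hab hg hgI
  have huc := isCompact_Icc.uniformContinuousOn_of_continuous (hq.mono hI)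
  rw [Metric.uniformContinuousOn_iff] at huc
  rw [Metric.tendstoUniformlyOn_iff] at hF ⊢
  intro η hη
  obtain ⟨δ', hδ', h1⟩ := huc η hη
  filter_upwards [hF (min δ δ') (lt_min hδ hδ')] with s hs x hx
  have h2 := hs x hx
  have h3 := hr x hx
  have h4 := h2.trans_le (min_le_left _ _)
  rw [Real.dist_eq, abs_lt] at h4
  exact h1 _ ⟨by linarith, by linarith⟩ _ ⟨by linarith, by linarith⟩ (h2.trans_le (min_le_right _ _))

/-- Difference quotients of a `C¹` function converge uniformly along a uniformly convergent
family. -/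
theorem tendstoUniformlyOn_dslope {I : Set ℝ} (hIo : IsOpen I) (hIc : I.OrdConnected) (hab : a ≤ b)
    {F : ι → ℝ → ℝ} {g q q' : ℝ → ℝ} (hF : TendstoUniformlyOn F g l (Icc a b))
    (hg : ContinuousOn g (Icc a b)) (hgI : ∀ x ∈ Icc a b, g x ∈ I)
    (hq : ∀ u ∈ I, HasDerivAt q (q' u) u) (hq' : ContinuousOn q' I) :
    TendstoUniformlyOn (fun s x => dslope q (g x) (F s x)) (fun x => q' (g x)) l (Icc a b) := by
  obtain ⟨m, M, δ, hδ, hI, hr⟩ := exists_range hIo hIc hab hg hgI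
  have huc := isCompact_Icc.uniformContinuousOn_of_continuous (hq'.mono hI)
  rw [Metric.uniformContinuousOn_iff] at huc
  rw [Metric.tendstoUniformlyOn_iff] at hF ⊢
  intro η hη
  obtain ⟨δ', hδ', h1⟩ := huc η hη
  filter_upwards [hF (min δ δ') (lt_min hδ hδ')] with s hs x hx
  have h2 := hs x hx
  have h3 := hr x hx
  have h4 := h2.trans_le (min_le_left _ _)
  have h5 := h2.trans_le (min_le_right _ _)
  rw [Real.dist_eq, abs_lt] at h4
  have hgm : g x ∈ Icc m M := ⟨by linarith, by linarith⟩
  have hFm : F s x ∈ Icc m M := ⟨by linarith, by linarith⟩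
  have hd : ∀ u ∈ Icc m M, HasDerivAt q (q' u) u := fun u hu => hq u (hI hu)
  by_cases heq : F s x = g x
  · rw [heq, dslope_same, (hd _ hgm).deriv, dist_self]
    exact hη
  obtain ⟨ξ, hξ, hξ', hξ''⟩ : ∃ ξ ∈ Icc m M, dist (g x) ξ < δ' ∧
      dslope q (g x) (F s x) = q' ξ := by
    rw [dslope_of_ne _ heq, slope_def_field]
    rw [Real.dist_eq, abs_lt] at h5
    simp only [Real.dist_eq, abs_lt]
    rcases lt_or_gt_of_ne heq with hlt | hlt
    · have hsub : Icc (F s x) (g x) ⊆ Icc m M := Icc_subset_Icc hFm.1 hgm.2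
      obtain ⟨ξ, hξ, e⟩ := exists_hasDerivAt_eq_slope q q' hlt
        (fun u hu => (hd u (hsub hu)).continuousAt.continuousWithinAt)
        (fun u hu => hd u (hsub (Ioo_subset_Icc_self hu)))
      refine ⟨ξ, hsub (Ioo_subset_Icc_self hξ), ⟨by linarith [hξ.2], by linarith [hξ.1]⟩, ?_⟩
      rw [e, ← neg_div_neg_eq, neg_sub, neg_sub]
    · have hsub : Icc (g x) (F s x) ⊆ Icc m M := Icc_subset_Icc hgm.1 hFm.2
      obtain ⟨ξ, hξ, e⟩ := exists_hasDerivAt_eq_slope q q' hlt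
        (fun u hu => (hd u (hsub hu)).continuousAt.continuousWithinAt)
        (fun u hu => hd u (hsub (Ioo_subset_Icc_self hu)))
      exact ⟨ξ, hsub (Ioo_subset_Icc_self hξ), ⟨by linarith [hξ.2], by linarith [hξ.1]⟩, e.symm⟩
  rw [hξ'']
  exact h1 _ hgm _ hξ hξ'

theorem exists_abs_bound {q : ℝ → ℝ} (hq : ContinuousOn q (Icc a b)) :
    ∃ C, ∀ x ∈ Icc a b, |q x| ≤ C := isCompact_Icc.exists_bound_of_continuousOn hq

theorem MemH1.memLp (hab : a ≤ b) {w : ℝ → ℝ} (hw : MemH1 a b w) :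
    MemLp w 2 (volume.restrict (Ioo a b)) := memLp_continuousOn (hw.continuousOn hab)

theorem MemH1.dx_sub {w w' : ℝ → ℝ} (hw : MemH1 a b w) (hw' : MemH1 a b w') :
    dx a b (fun x => w x - w' x) =ᵐ[volume.restrict (Ioo a b)]
      fun x => dx a b w x - dx a b w' x := by
  filter_upwards [ae_hasDerivAt_dx hw.1, ae_hasDerivAt_dx hw'.1, ae_restrict_mem measurableSet_Ioo]
    with x h1 h2 hx
  rw [dx_eq_deriv _ hx]
  exact (h1.sub h2).deriv

theorem MemH1.sub {w w' : ℝ → ℝ} (hw : MemH1 a b w) (hw' : MemH1 a b w') :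
    MemH1 a b (fun x => w x - w' x) :=
  ⟨hw.1.fun_sub hw'.1, (hw.2.sub hw'.2).ae_eq (hw.dx_sub hw').symm⟩

/-- Consequences of the convergence in `H¹(a, b)`. -/
theorem tendsto_of_h1Norm (hab : a < b) {w : ι → ℝ → ℝ} {g : ℝ → ℝ}
    (hw : ∀ᶠ s in l, MemH1 a b (w s)) (hg : MemH1 a b g)
    (h : Tendsto (fun s => h1Norm a b (fun x => w s x - g x)) l (𝓝 0)) :
    TendstoUniformlyOn w g l (Icc a b) ∧ TendstoL2 a b w l g ∧
      TendstoL2 a b (fun s => dx a b (w s)) l (dx a b g) := by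
  refine ⟨?_, ?_, ?_⟩
  · rw [Metric.tendstoUniformlyOn_iff]
    intro η hη
    filter_upwards [tendsto_unif_of_h1Norm hab (hw.mono fun s hs => hs.sub hg) h hη] with s hs x hx
    rw [dist_comm]
    exact hs x hx
  · exact tendsto_of_tendsto_of_tendsto_of_le_of_le tendsto_const_nhds h
      (fun _ => zero_le) fun _ => le_self_add
  · refine tendsto_of_tendsto_of_tendsto_of_le_of_le' tendsto_const_nhds h
      (Eventually.of_forall fun _ => zero_le) ?_
    filter_upwards [hw] with s hs
    refine le_trans (le_of_eq ?_) (le_add_self : _ ≤ h1Norm a b (fun x => w s x - g x))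
    exact (eLpNorm_congr_ae (hs.dx_sub hg)).symm

end L2

/-! ### Continuity and increments of the energy and of the flux -/

section EnergyFlow

variable {ι : Type*} {l : Filter ι} {D f : ℝ → ℝ} {I : Set ℝ} {d α β a b ε : ℝ}

theorem energy_eq (H : IsModel D f I d α β) (hab : a < b) {w : ℝ → ℝ} (hw : MemH1 a b w)
    (hwI : ∀ x ∈ Icc a b, w x ∈ I) :
    energy D f α a b ε w =
      ε / 2 * (∫ x in Ioo a b, (D (w x) * dx a b w x) * (D (w x) * dx a b w x)) +
        ε⁻¹ * ∫ x in Ioo a b, potential D f α (w x) * 1 := by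
  rw [energy, intervalIntegral.integral_of_le hab.le, integral_Ioc_eq_integral_Ioo, integral_add]
  · rw [integral_const_mul, integral_div]
    simp only [pow_two, mul_one]
    ring
  · exact ((memLp_flux H hab.le hw hwI).integrable_sq).const_mul _
  · exact ((memLp_continuousOn (p := 1) (H.continuousOn_potential.comp (hw.continuousOn hab.le)
      hwI)).integrable le_rfl).div_const _

theorem tendstoL2_comp (hIo : IsOpen I) (hIc : I.OrdConnected) (hab : a ≤ b)
    {F : ι → ℝ → ℝ} {g q : ℝ → ℝ} (hF : TendstoUniformlyOn F g l (Icc a b))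
    (hg : ContinuousOn g (Icc a b)) (hgI : ∀ x ∈ Icc a b, g x ∈ I) (hq : ContinuousOn q I) :
    TendstoL2 a b (fun s x => q (F s x)) l (fun x => q (g x)) := by
  obtain ⟨C, hC⟩ := exists_abs_bound (hq.comp hg hgI)
  have h1 : MemLp (fun _ : ℝ => (1 : ℝ)) 2 (volume.restrict (Ioo a b)) := memLp_const 1
  simpa using TendstoL2.bdd_mul (tendstoUniformlyOn_comp hIo hIc hab hF hg hgI hq) hC
    (tendstoL2_const (l := l) (fun _ : ℝ => (1 : ℝ))) (Eventually.of_forall fun _ => h1) h1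

/-- The energy is continuous with respect to the convergence in `H¹(a, b)`. -/
theorem tendsto_energy (H : IsModel D f I d α β) (hab : a < b) {w : ι → ℝ → ℝ} {g : ℝ → ℝ}
    (hw : ∀ᶠ s in l, MemH1 a b (w s)) (hwI : ∀ᶠ s in l, ∀ x ∈ Icc a b, w s x ∈ I)
    (hg : MemH1 a b g) (hgI : ∀ x ∈ Icc a b, g x ∈ I)
    (h : Tendsto (fun s => h1Norm a b (fun x => w s x - g x)) l (𝓝 0)) :
    Tendsto (fun s => energy D f α a b ε (w s)) l (𝓝 (energy D f α a b ε g)) := by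
  obtain ⟨hU, -, hV⟩ := tendsto_of_h1Norm hab hw hg h
  have hgc := hg.continuousOn hab.le
  have hDc := H.contDiff_D.continuousOn
  obtain ⟨C, hC⟩ := exists_abs_bound (hDc.comp hgc hgI)
  have hP : TendstoL2 a b (fun s x => D (w s x) * dx a b (w s) x) l
      (fun x => D (g x) * dx a b g x) :=
    TendstoL2.bdd_mul (tendstoUniformlyOn_comp H.isOpen H.ordConn hab.le hU hgc hgI hDc) hC hV
      (hw.mono fun s hs => hs.2) hg.2
  have hG := tendstoL2_comp H.isOpen H.ordConn hab.le hU hgc hgI H.continuousOn_potential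
  have h1 : MemLp (fun _ : ℝ => (1 : ℝ)) 2 (volume.restrict (Ioo a b)) := memLp_const 1
  have hPm : ∀ᶠ s in l, MemLp (fun x => D (w s x) * dx a b (w s) x) 2
      (volume.restrict (Ioo a b)) := by
    filter_upwards [hw, hwI] with s hs hs' using memLp_flux H hab.le hs hs'
  have hGm : ∀ᶠ s in l, MemLp (fun x => potential D f α (w s x)) 2
      (volume.restrict (Ioo a b)) := by
    filter_upwards [hw, hwI] with s hs hs'
    exact memLp_continuousOn (H.continuousOn_potential.comp (hs.continuousOn hab.le) hs')
  have hgm := memLp_flux H hab.le hg hgI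
  have t1 := tendsto_integral_mul_of_tendstoL2 hP hP hPm hPm hgm hgm
  have t2 := tendsto_integral_mul_of_tendstoL2 hG (tendstoL2_const _) hGm
    (Eventually.of_forall fun _ => h1)
    (memLp_continuousOn (H.continuousOn_potential.comp hgc hgI)) h1
  rw [energy_eq H hab hg hgI]
  refine ((t1.const_mul (ε / 2)).add (t2.const_mul ε⁻¹)).congr' ?_
  filter_upwards [hw, hwI] with s hs hs'
  rw [energy_eq H hab hs hs']

/-- The flux `D(w) w_x`. -/
noncomputable def flux (D : ℝ → ℝ) (a b : ℝ) (w : ℝ → ℝ) (x : ℝ) : ℝ := D (w x) * dx a b w x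

/-- The expanded form displays (D(w) w_x)_x as products of uniformly convergent and L² convergent
factors under H² convergence. -/
theorem ae_dx_flux (H : IsModel D f I d α β) {w : ℝ → ℝ} (hw : MemH2 a b w)
    (hwI : ∀ x ∈ Icc a b, w x ∈ I) :
    dx a b (flux D a b w) =ᵐ[volume.restrict (Ioo a b)] fun x =>
      deriv D (w x) * (dx a b w x * dx a b w x) + D (w x) * dx a b (dx a b w) x := by
  filter_upwards [ae_hasDerivAt_dx hw.1.1, ae_hasDerivAt_dx hw.2.2.1,
    ae_restrict_mem measurableSet_Ioo] with x h1 h2 hx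
  have h3 := hasDerivAt_of_contDiffOn_two H.isOpen H.contDiff_D (hwI x (Ioo_subset_Icc_self hx))
  have h4 : HasDerivAt (flux D a b w) (deriv D (w x) * dx a b w x * dx a b w x +
      D (w x) * dx a b (dx a b w) x) x := (h3.comp x h1).mul h2
  rw [dx_eq_deriv _ hx, h4.deriv]
  ring

theorem memLp_dx_flux_aux (H : IsModel D f I d α β) (hab : a ≤ b) {w : ℝ → ℝ} (hw : MemH2 a b w)
    (hwI : ∀ x ∈ Icc a b, w x ∈ I) :
    MemLp (fun x => dx a b w x * dx a b w x) 2 (volume.restrict (Ioo a b)) ∧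
    MemLp (fun x => deriv D (w x) * (dx a b w x * dx a b w x)) 2 (volume.restrict (Ioo a b)) ∧
    MemLp (fun x => D (w x) * dx a b (dx a b w) x) 2 (volume.restrict (Ioo a b)) := by
  have hwc := hw.1.continuousOn hab
  have hvc := hw.2.2.continuousOn hab
  refine ⟨memLp_continuousOn (hvc.mul hvc), memLp_continuousOn (ContinuousOn.mul ?_ (hvc.mul hvc)),
    memLp_continuousOn_mul (H.contDiff_D.continuousOn.comp hwc hwI) hw.2.2.2⟩
  exact (continuousOn_deriv_of_contDiffOn_two H.isOpen H.contDiff_D).comp hwc hwI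

theorem memH1_flux (H : IsModel D f I d α β) (hab : a ≤ b) {w : ℝ → ℝ} (hw : MemH2 a b w)
    (hwI : ∀ x ∈ Icc a b, w x ∈ I) : MemH1 a b (flux D a b w) := by
  obtain ⟨-, h1, h2⟩ := memLp_dx_flux_aux H hab hw hwI
  refine ⟨?_, (h1.add h2).ae_eq (ae_dx_flux H hw hwI).symm⟩
  have hDw : AbsolutelyContinuousOnInterval (fun x => D (w x)) a b :=
    absolutelyContinuous_comp (g := D) H.isOpen H.ordConn hab hw.1.1 hwI
      (fun u hu => hasDerivAt_of_contDiffOn_two H.isOpen H.contDiff_D hu)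
      (continuousOn_deriv_of_contDiffOn_two H.isOpen H.contDiff_D)
  exact hDw.fun_mul hw.2.2.1

theorem MemH2.dx_sub {w w' : ℝ → ℝ} (hw : MemH2 a b w) (hw' : MemH2 a b w') :
    ∀ x ∈ Icc a b, dx a b (fun y => w y - w' y) x = dx a b w x - dx a b w' x := fun x hx =>
  derivWithin_fun_sub (hw.2.1 x hx) (hw'.2.1 x hx)

theorem MemH2.h1Norm_dx_sub_le {w w' : ℝ → ℝ} (hw : MemH2 a b w)
    (hw' : MemH2 a b w') :
    h1Norm a b (fun x => dx a b w x - dx a b w' x) ≤ h2Norm a b (fun x => w x - w' x) := by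
  have e := MemH2.dx_sub hw hw'
  refine add_le_add ?_ (le_of_eq ?_)
  · refine le_trans (le_of_eq ?_) le_add_self
    refine eLpNorm_congr_ae ?_
    filter_upwards [ae_restrict_mem measurableSet_Ioo] with x hx
    rw [e x (Ioo_subset_Icc_self hx)]
  · refine eLpNorm_congr_ae ?_
    filter_upwards [ae_restrict_mem measurableSet_Ioo] with x hx
    exact (derivWithin_congr e (e x (Ioo_subset_Icc_self hx))).symm

/-- The derivative of the flux is continuous with respect to the convergence in `H²(a, b)`. -/
theorem tendstoL2_dx_flux (H : IsModel D f I d α β) (hab : a < b) {w : ι → ℝ → ℝ} {g : ℝ → ℝ}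
    (hw : ∀ᶠ s in l, MemH2 a b (w s)) (hwI : ∀ᶠ s in l, ∀ x ∈ Icc a b, w s x ∈ I)
    (hg : MemH2 a b g) (hgI : ∀ x ∈ Icc a b, g x ∈ I)
    (h : Tendsto (fun s => h2Norm a b (fun x => w s x - g x)) l (𝓝 0)) :
    TendstoL2 a b (fun s => dx a b (flux D a b (w s))) l (dx a b (flux D a b g)) := by
  have h1 : Tendsto (fun s => h1Norm a b (fun x => w s x - g x)) l (𝓝 0) :=
    tendsto_of_tendsto_of_tendsto_of_le_of_le tendsto_const_nhds h
      (fun _ => zero_le) fun _ => le_self_add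
  have h2 : Tendsto (fun s => h1Norm a b (fun x => dx a b (w s) x - dx a b g x)) l (𝓝 0) := by
    refine tendsto_of_tendsto_of_tendsto_of_le_of_le' tendsto_const_nhds h
      (Eventually.of_forall fun _ => zero_le) ?_
    filter_upwards [hw] with s hs using MemH2.h1Norm_dx_sub_le hs hg
  obtain ⟨hU, -, -⟩ := tendsto_of_h1Norm hab (hw.mono fun s hs => hs.1) hg.1 h1
  obtain ⟨hV, hV2, hW⟩ := tendsto_of_h1Norm hab (hw.mono fun s hs => hs.2.2) hg.2.2 h2
  have hgc := hg.1.continuousOn hab.le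
  have hvc := hg.2.2.continuousOn hab.le
  have hDc := H.contDiff_D.continuousOn
  have hD'c := continuousOn_deriv_of_contDiffOn_two H.isOpen H.contDiff_D
  obtain ⟨C₁, hC₁⟩ := exists_abs_bound (hDc.comp hgc hgI)
  obtain ⟨C₂, hC₂⟩ := exists_abs_bound (hD'c.comp hgc hgI)
  obtain ⟨C₃, hC₃⟩ := exists_abs_bound hvc
  have m := (hw.and hwI).mono fun s hs => memLp_dx_flux_aux H hab.le hs.1 hs.2
  obtain ⟨mg1, mg2, mg3⟩ := memLp_dx_flux_aux H hab.le hg hgI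
  have t1 : TendstoL2 a b (fun s x => dx a b (w s) x * dx a b (w s) x) l
      (fun x => dx a b g x * dx a b g x) :=
    TendstoL2.bdd_mul hV hC₃ hV2 (hw.mono fun s hs => hs.2.2.memLp hab.le) (hg.2.2.memLp hab.le)
  have t2 := TendstoL2.bdd_mul
    (tendstoUniformlyOn_comp H.isOpen H.ordConn hab.le hU hgc hgI hD'c) hC₂ t1
    (m.mono fun s hs => hs.1) mg1
  have t3 := TendstoL2.bdd_mul
    (tendstoUniformlyOn_comp H.isOpen H.ordConn hab.le hU hgc hgI hDc) hC₁ hW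
    (hw.mono fun s hs => hs.2.2.2) hg.2.2.2
  refine (t2.add t3 (m.mono fun s hs => hs.2.1) (m.mono fun s hs => hs.2.2) mg2 mg3).congr' ?_
    (ae_dx_flux H hg hgI).symm
  filter_upwards [hw, hwI] with s hs hs' using (ae_dx_flux H hs hs').symm

/-- Difference quotients of `q ∘ u` converge in `L²`. -/
theorem tendstoL2_quotient {κ : ι → ℝ} (hIo : IsOpen I) (hIc : I.OrdConnected) (hab : a ≤ b)
    {w : ι → ℝ → ℝ} {g gt q q' : ℝ → ℝ} (hU : TendstoUniformlyOn w g l (Icc a b))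
    (hw : ∀ᶠ s in l, ContinuousOn (w s) (Icc a b)) (hg : ContinuousOn g (Icc a b))
    (hgI : ∀ x ∈ Icc a b, g x ∈ I)
    (hgt : MemLp gt 2 (volume.restrict (Ioo a b)))
    (ht : TendstoL2 a b (fun s x => (w s x - g x) / κ s) l gt)
    (hq : ∀ u ∈ I, HasDerivAt q (q' u) u) (hq' : ContinuousOn q' I) :
    TendstoL2 a b (fun s x => (q (w s x) - q (g x)) / κ s) l (fun x => q' (g x) * gt x) := by
  obtain ⟨C, hC⟩ := exists_abs_bound (hq'.comp hg hgI)
  have hm : ∀ᶠ s in l, MemLp (fun x => (w s x - g x) / κ s) 2 (volume.restrict (Ioo a b)) :=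
    hw.mono fun s hs => memLp_continuousOn ((hs.sub hg).div_const _)
  have := TendstoL2.bdd_mul (tendstoUniformlyOn_dslope hIo hIc hab hU hg hgI hq hq') hC ht hm hgt
  refine this.congr' (Eventually.of_forall fun s => Eventually.of_forall fun x => ?_)
    (Eventually.of_forall fun _ => rfl)
  have := sub_smul_dslope q (g x) (w s x)
  simp only [smul_eq_mul] at this
  simp only [← this]
  ring

/-- Difference of the energies of two states that satisfy the Neumann condition. -/
theorem energy_sub_energy (H : IsModel D f I d α β) (hab : a < b) {w g : ℝ → ℝ}
    (hw : MemH2 a b w) (hwI : ∀ x ∈ Icc a b, w x ∈ I) (hg : MemH2 a b g)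
    (hgI : ∀ x ∈ Icc a b, g x ∈ I) (hwa : dx a b w a = 0) (hwb : dx a b w b = 0)
    (hga : dx a b g a = 0) (hgb : dx a b g b = 0) {K : ℝ → ℝ}
    (hK : ∀ u ∈ I, HasDerivAt K (D u) u) :
    energy D f α a b ε w - energy D f α a b ε g =
      -(ε / 2) * (∫ x in Ioo a b, (K (w x) - K (g x)) *
          (dx a b (flux D a b w) x + dx a b (flux D a b g) x)) +
        ε⁻¹ * ∫ x in Ioo a b, (potential D f α (w x) - potential D f α (g x)) * 1 := by
  have hDc := H.contDiff_D.continuousOn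
  have hKac : ∀ {w : ℝ → ℝ}, MemH1 a b w → (∀ x ∈ Icc a b, w x ∈ I) →
      AbsolutelyContinuousOnInterval (fun x => K (w x)) a b := fun hw hwI =>
    absolutelyContinuous_comp (g := K) H.isOpen H.ordConn hab.le hw.1 hwI hK hDc
  have pw := memH1_flux H hab.le hw hwI
  have pg := memH1_flux H hab.le hg hgI
  have hz := (hKac hw.1 hwI).fun_sub (hKac hg.1 hgI)
  have hy := pw.1.fun_add pg.1
  -- With p the flux and K' = D, p_w² - p_g² = (p_w + p_g)(K(w) - K(g))_x. One integration by parts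
  -- moves the space derivative to the fluxes, and the Neumann conditions remove the boundary terms.
  -- The resulting difference quotient in time needs only L² differentiability of u, and no
  -- derivative u_xt.
  have hibp := hy.integral_mul_deriv_eq_deriv_mul hz
  have e1 : flux D a b w a = 0 := by simp [flux, hwa]
  have e2 : flux D a b w b = 0 := by simp [flux, hwb]
  have e3 : flux D a b g a = 0 := by simp [flux, hga]
  have e4 : flux D a b g b = 0 := by simp [flux, hgb]
  simp only [e1, e2, e3, e4, add_zero, zero_mul, sub_zero, zero_sub] at hibp
  rw [intervalIntegral.integral_of_le hab.le, intervalIntegral.integral_of_le hab.le,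
    integral_Ioc_eq_integral_Ioo, integral_Ioc_eq_integral_Ioo] at hibp
  have hL : ∫ x in Ioo a b, (flux D a b w x + flux D a b g x) *
      deriv (fun x => K (w x) - K (g x)) x =
      (∫ x in Ioo a b, flux D a b w x * flux D a b w x) -
        ∫ x in Ioo a b, flux D a b g x * flux D a b g x := by
    have i1 : Integrable (fun x => flux D a b w x * flux D a b w x) (volume.restrict (Ioo a b)) :=
      (pw.memLp hab.le).integrable_mul (pw.memLp hab.le)
    have i2 : Integrable (fun x => flux D a b g x * flux D a b g x) (volume.restrict (Ioo a b)) :=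
      (pg.memLp hab.le).integrable_mul (pg.memLp hab.le)
    rw [← integral_sub i1 i2]
    refine integral_congr_ae ?_
    filter_upwards [ae_hasDerivAt_dx hw.1.1, ae_hasDerivAt_dx hg.1.1,
      ae_restrict_mem measurableSet_Ioo] with x h1 h2 hx
    have hx' := Ioo_subset_Icc_self hx
    have h3 : HasDerivAt (fun x => K (w x) - K (g x)) (flux D a b w x - flux D a b g x) x :=
      ((hK _ (hwI x hx')).comp x h1).sub ((hK _ (hgI x hx')).comp x h2)
    rw [h3.deriv]
    ring
  have hR : ∫ x in Ioo a b, deriv (fun x => flux D a b w x + flux D a b g x) x *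
      (K (w x) - K (g x)) = ∫ x in Ioo a b, (K (w x) - K (g x)) *
          (dx a b (flux D a b w) x + dx a b (flux D a b g) x) := by
    refine integral_congr_ae ?_
    filter_upwards [ae_hasDerivAt_dx pw.1, ae_hasDerivAt_dx pg.1] with x h1 h2
    have h3 : HasDerivAt (fun x => flux D a b w x + flux D a b g x) _ x := h1.add h2
    rw [h3.deriv]
    ring
  rw [hL, hR] at hibp
  have hGi : ∀ {w : ℝ → ℝ}, MemH1 a b w → (∀ x ∈ Icc a b, w x ∈ I) →
      Integrable (fun x => potential D f α (w x) * 1) (volume.restrict (Ioo a b)) :=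
    fun hw hwI => ((memLp_continuousOn (p := 1) (H.continuousOn_potential.comp
      (hw.continuousOn hab.le) hwI)).integrable le_rfl).mul_const 1
  have hG : ∫ x in Ioo a b, (potential D f α (w x) - potential D f α (g x)) * 1 =
      (∫ x in Ioo a b, potential D f α (w x) * 1) - ∫ x in Ioo a b, potential D f α (g x) * 1 := by
    rw [← integral_sub (hGi hw.1 hwI) (hGi hg.1 hgI)]
    simp only [sub_mul]
  rw [energy_eq H hab hw.1 hwI, energy_eq H hab hg.1 hgI, hG]
  simp only [flux] at hibp ⊢
  linear_combination (ε / 2) * hibp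

end EnergyFlow

/-! ### Energy identity and the solution as a curve in L²(a, b) -/

section Solution

variable {D f : ℝ → ℝ} {I : Set ℝ} {d α β a b ε : ℝ} {u₀ : ℝ → ℝ} {u ut : ℝ → ℝ → ℝ}

theorem continuousOn_energy (H : IsModel D f I d α β) (hab : a < b)
    (hS : IsSolution D f I a b ε u₀ u ut) :
    ContinuousOn (fun t => energy D f α a b ε (u t)) (Ici 0) := by
  intro t ht
  refine tendsto_energy H hab ?_ ?_ (hS.memH1 t ht) (hS.mem_I t ht) (hS.contH1 t ht)
  · filter_upwards [self_mem_nhdsWithin] with s hs using hS.memH1 s hs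
  · filter_upwards [self_mem_nhdsWithin] with s hs using hS.mem_I s hs

/-- The energy identity. -/
theorem hasDerivAt_energy (H : IsModel D f I d α β) (hab : a < b) (hε : 0 < ε)
    (hS : IsSolution D f I a b ε u₀ u ut) {t : ℝ} (ht : 0 < t) :
    HasDerivAt (fun t => energy D f α a b ε (u t))
      (-(ε⁻¹ * ∫ x in Ioo a b, D (u t x) * ut t x * ut t x)) t := by
  have hpos : ∀ᶠ s in 𝓝[≠] t, 0 < s :=
    nhdsWithin_le_nhds (eventually_gt_nhds ht)
  have hDc := H.contDiff_D.continuousOn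
  have hfDc : ContinuousOn (fun s => f s * D s) I := H.contDiff_f.continuousOn.mul hDc
  have hw : ∀ᶠ s in 𝓝[≠] t, MemH2 a b (u s) := hpos.mono fun s hs => hS.memH2 s hs
  have hwI : ∀ᶠ s in 𝓝[≠] t, ∀ x ∈ Icc a b, u s x ∈ I := hpos.mono fun s hs => hS.mem_I s hs.le
  have hg := hS.memH2 t ht
  have hgI := hS.mem_I t ht.le
  have hgc := hg.1.continuousOn hab.le
  have hH2 := (hS.contH2 t ht).mono_left (nhdsWithin_le_nhds (s := {t}ᶜ))
  have hH1 : Tendsto (fun s => h1Norm a b (fun x => u s x - u t x)) (𝓝[≠] t) (𝓝 0) :=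
    tendsto_of_tendsto_of_tendsto_of_le_of_le tendsto_const_nhds hH2
      (fun _ => zero_le) fun _ => le_self_add
  obtain ⟨hU, -, -⟩ := tendsto_of_h1Norm hab (hw.mono fun s hs => hs.1) hg.1 hH1
  have hP := tendstoL2_dx_flux H hab hw hwI hg hgI hH2
  have hwc : ∀ᶠ s in 𝓝[≠] t, ContinuousOn (u s) (Icc a b) :=
    hw.mono fun s hs => hs.1.continuousOn hab.le
  have hut := hS.memL2_ut t ht
  set K : ℝ → ℝ := fun y => ∫ s in α..y, D s with hKdef
  have hK : ∀ y ∈ I, HasDerivAt K (D y) y := fun y hy =>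
    hasDerivAt_primitive H.isOpen H.ordConn hDc H.left_mem hy
  have hKc : ContinuousOn K I := fun y hy => (hK y hy).continuousAt.continuousWithinAt
  have hZ := tendstoL2_quotient H.isOpen H.ordConn hab.le hU hwc hgc hgI hut
    (hS.time_deriv t ht) hK hDc
  have hG := tendstoL2_quotient H.isOpen H.ordConn hab.le hU hwc hgc hgI hut
    (hS.time_deriv t ht) (fun y hy => H.hasDerivAt_potential hy) hfDc
  have hquot : ∀ {q : ℝ → ℝ}, ContinuousOn q I →
      ∀ᶠ s in 𝓝[≠] t, MemLp (fun x => (q (u s x) - q (u t x)) / (s - t)) 2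
        (volume.restrict (Ioo a b)) := by
    intro q hq
    filter_upwards [hwc, hwI] with s hs hs'
    exact memLp_continuousOn (((hq.comp hs hs').sub (hq.comp hgc hgI)).div_const _)
  have hpm : ∀ᶠ s in 𝓝[≠] t, MemLp (dx a b (flux D a b (u s))) 2 (volume.restrict (Ioo a b)) := by
    filter_upwards [hw, hwI] with s hs hs' using (memH1_flux H hab.le hs hs').2
  have hpt := (memH1_flux H hab.le hg hgI).2
  have h1 : MemLp (fun _ : ℝ => (1 : ℝ)) 2 (volume.restrict (Ioo a b)) := memLp_const 1
  have hDut : MemLp (fun x => D (u t x) * ut t x) 2 (volume.restrict (Ioo a b)) :=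
    memLp_continuousOn_mul (hDc.comp hgc hgI) hut
  have hfDut : MemLp (fun x => f (u t x) * D (u t x) * ut t x) 2 (volume.restrict (Ioo a b)) :=
    memLp_continuousOn_mul (hfDc.comp hgc hgI) hut
  have T1 := tendsto_integral_mul_of_tendstoL2 hZ
    (hP.add (tendstoL2_const (dx a b (flux D a b (u t)))) hpm (Eventually.of_forall fun _ => hpt)
      hpt hpt) (hquot hKc) (hpm.mono fun s hs => hs.add hpt) hDut (hpt.add hpt)
  have T2 := tendsto_integral_mul_of_tendstoL2 hG (tendstoL2_const (fun _ => (1 : ℝ)))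
    (hquot H.continuousOn_potential) (Eventually.of_forall fun _ => h1) hfDut h1
  have T := (T1.const_mul (-(ε / 2))).add (T2.const_mul ε⁻¹)
  rw [hasDerivAt_iff_tendsto_slope]
  -- In the limit the two fluxes coincide, and the integrand becomes -ε⁻¹ D u_t (ε² p_x - f) with p
  -- the flux; the bracket is u_t by the equation.
  have hlim : -(ε / 2) * (∫ x in Ioo a b, D (u t x) * ut t x *
        (dx a b (flux D a b (u t)) x + dx a b (flux D a b (u t)) x)) +
      ε⁻¹ * (∫ x in Ioo a b, f (u t x) * D (u t x) * ut t x * 1) =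
      -(ε⁻¹ * ∫ x in Ioo a b, D (u t x) * ut t x * ut t x) := by
    have i1 : Integrable (fun x => D (u t x) * ut t x *
        (dx a b (flux D a b (u t)) x + dx a b (flux D a b (u t)) x))
        (volume.restrict (Ioo a b)) := hDut.integrable_mul (hpt.add hpt)
    have i2 : Integrable (fun x => f (u t x) * D (u t x) * ut t x * 1)
        (volume.restrict (Ioo a b)) := hfDut.integrable_mul h1
    rw [← integral_const_mul, ← integral_const_mul, ← integral_const_mul, ← integral_neg,
      ← integral_add (i1.const_mul _) (i2.const_mul _)]
    refine integral_congr_ae ?_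
    filter_upwards [hS.equation t ht] with x hx
    change ut t x = ε ^ 2 * dx a b (flux D a b (u t)) x - f (u t x) at hx
    have hε' := hε.ne'
    generalize dx a b (flux D a b (u t)) x = p at hx ⊢
    have : f (u t x) = ε ^ 2 * p - ut t x := by rw [hx]; ring
    rw [this]
    field_simp
    ring
  rw [hlim] at T
  refine T.congr' ?_
  filter_upwards [hpos, hw, hwI, self_mem_nhdsWithin] with s hs hs2 hsI hne
  have hne' : s - t ≠ 0 := sub_ne_zero.2 hne
  obtain ⟨na, nb⟩ := hS.neumann s hs
  obtain ⟨ma, mb⟩ := hS.neumann t ht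
  rw [slope_def_field, energy_sub_energy H hab hs2 hsI hg hgI na nb ma mb hK, add_div,
    mul_div_assoc, mul_div_assoc, ← integral_div, ← integral_div]
  simp only [div_mul_eq_mul_div]

theorem normL_two_sq {g : ℝ → ℝ} (hg : MemLp g 2 (volume.restrict (Ioo a b))) :
    normL a b 2 g ^ 2 = ENNReal.ofReal (∫ x in Ioo a b, g x * g x) := by
  have h0 : 0 ≤ ∫ x in Ioo a b, g x ^ 2 := integral_nonneg fun _ => sq_nonneg _
  rw [normL, hg.eLpNorm_eq_integral_rpow_norm (by norm_num) (by norm_num),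
    ← ENNReal.ofReal_pow (by positivity)]
  congr 1
  simp only [ENNReal.toReal_ofNat, Real.rpow_ofNat, Real.norm_eq_abs, sq_abs]
  rw [← Real.rpow_natCast, ← Real.rpow_mul h0]
  norm_num
  simp only [pow_two]

theorem mul_integral_ut_sq_le (H : IsModel D f I d α β) (hab : a < b)
    (hS : IsSolution D f I a b ε u₀ u ut) {t : ℝ} (ht : 0 < t) :
    d * (∫ x in Ioo a b, ut t x * ut t x) ≤ ∫ x in Ioo a b, D (u t x) * ut t x * ut t x := by
  have hut := hS.memL2_ut t ht
  have hDut : MemLp (fun x => D (u t x) * ut t x) 2 (volume.restrict (Ioo a b)) :=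
    memLp_continuousOn_mul (H.contDiff_D.continuousOn.comp
      ((hS.memH1 t ht.le).continuousOn hab.le) (hS.mem_I t ht.le)) hut
  rw [← integral_const_mul]
  refine setIntegral_mono_on ((hut.integrable_mul hut).const_mul d) (hDut.integrable_mul hut)
    measurableSet_Ioo fun x hx => ?_
  rw [mul_assoc]
  exact mul_le_mul_of_nonneg_right (H.le_D _ (hS.mem_I t ht.le x (Ioo_subset_Icc_self hx)))
    (mul_self_nonneg _)

/-- The class in `L²(a, b)` of a function (zero if the function is not square integrable). -/
noncomputable def toL2 (a b : ℝ) (w : ℝ → ℝ) : Lp ℝ 2 (volume.restrict (Ioo a b)) :=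
  open Classical in
  if h : MemLp w 2 (volume.restrict (Ioo a b)) then h.toLp w else 0

theorem toL2_eq {w : ℝ → ℝ} (h : MemLp w 2 (volume.restrict (Ioo a b))) :
    toL2 a b w = h.toLp w := dif_pos h

theorem norm_toL2 {w : ℝ → ℝ} (h : MemLp w 2 (volume.restrict (Ioo a b))) :
    ‖toL2 a b w‖ = (normL a b 2 w).toReal := by
  rw [toL2_eq h, Lp.norm_toLp]; rfl

theorem norm_toL2_sq {w : ℝ → ℝ} (h : MemLp w 2 (volume.restrict (Ioo a b))) :
    ‖toL2 a b w‖ ^ 2 = ∫ x in Ioo a b, w x * w x := by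
  rw [norm_toL2 h, ← ENNReal.toReal_pow, normL_two_sq h, ENNReal.toReal_ofReal]
  exact integral_nonneg fun _ => mul_self_nonneg _

theorem toL2_sub {w w' : ℝ → ℝ} (h : MemLp w 2 (volume.restrict (Ioo a b)))
    (h' : MemLp w' 2 (volume.restrict (Ioo a b))) :
    toL2 a b w - toL2 a b w' = toL2 a b (fun x => w x - w' x) := by
  have h2 : MemLp (fun x => w x - w' x) 2 (volume.restrict (Ioo a b)) := h.sub h'
  rw [toL2_eq h, toL2_eq h', toL2_eq h2, ← MemLp.toLp_sub]; rfl

theorem smul_toL2 (c : ℝ) {w : ℝ → ℝ} (h : MemLp w 2 (volume.restrict (Ioo a b))) :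
    c • toL2 a b w = toL2 a b (fun x => c * w x) := by
  have h2 : MemLp (fun x => c * w x) 2 (volume.restrict (Ioo a b)) := h.const_mul c
  rw [toL2_eq h, toL2_eq h2, ← MemLp.toLp_const_smul]; rfl

/-- Restates the time derivative in the Banach space L², where the mean value inequality for
vector-valued curves applies. -/
theorem hasDerivAt_toL2 (hab : a < b) (hS : IsSolution D f I a b ε u₀ u ut) {t : ℝ} (ht : 0 < t) :
    HasDerivAt (fun s => toL2 a b (u s)) (toL2 a b (ut t)) t := by
  have hm : ∀ s, 0 ≤ s → MemLp (u s) 2 (volume.restrict (Ioo a b)) := fun s hs =>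
    (hS.memH1 s hs).memLp hab.le
  rw [hasDerivAt_iff_tendsto_slope, tendsto_iff_norm_sub_tendsto_zero]
  have h1 := (ENNReal.tendsto_toReal ENNReal.zero_ne_top).comp (hS.time_deriv t ht)
  refine h1.congr' ?_
  filter_upwards [nhdsWithin_le_nhds (eventually_gt_nhds ht)] with s hs
  have hs' : 0 ≤ s := (show 0 < s from hs).le
  have hd : MemLp (fun x => u s x - u t x) 2 (volume.restrict (Ioo a b)) :=
    (hm s hs').sub (hm t ht.le)
  have hd' : MemLp (fun x => (s - t)⁻¹ * (u s x - u t x)) 2 (volume.restrict (Ioo a b)) :=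
    hd.const_mul _
  have hd'' : MemLp (fun x => (s - t)⁻¹ * (u s x - u t x) - ut t x) 2
    (volume.restrict (Ioo a b)) := hd'.sub (hS.memL2_ut t ht)
  rw [slope_def_module, toL2_sub (hm s hs') (hm t ht.le), smul_toL2 _ hd,
    toL2_sub hd' (hS.memL2_ut t ht), norm_toL2 hd'']
  simp only [Function.comp, div_eq_inv_mul]

theorem continuousOn_toL2 (hab : a < b) (hS : IsSolution D f I a b ε u₀ u ut) :
    ContinuousOn (fun s => toL2 a b (u s)) (Ici 0) := by
  have hm : ∀ s, 0 ≤ s → MemLp (u s) 2 (volume.restrict (Ioo a b)) := fun s hs =>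
    (hS.memH1 s hs).memLp hab.le
  intro t ht
  rw [ContinuousWithinAt, tendsto_iff_norm_sub_tendsto_zero]
  have h0 : Tendsto (fun s => normL a b 2 (fun x => u s x - u t x)) (𝓝[Ici 0] t) (𝓝 0) :=
    tendsto_of_tendsto_of_tendsto_of_le_of_le tendsto_const_nhds (hS.contH1 t ht)
      (fun _ => zero_le) fun _ => le_self_add
  refine ((ENNReal.tendsto_toReal ENNReal.zero_ne_top).comp h0).congr' ?_
  filter_upwards [self_mem_nhdsWithin] with s hs
  have hd : MemLp (fun x => u s x - u t x) 2 (volume.restrict (Ioo a b)) :=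
    (hm s hs).sub (hm t ht)
  rw [toL2_sub (hm s hs) (hm t ht), norm_toL2 hd]
  rfl

end Solution

/-! ### Abstract dissipation estimates -/

section Dissipation

variable {X : Type*} [NormedAddCommGroup X] [NormedSpace ℝ X] {U U' : ℝ → X} {F F' : ℝ → ℝ}

/-- A curve whose squared speed is at most the dissipation rate of `F` moves slowly. -/
theorem norm_sub_le_of_dissipation (hU : ContinuousOn U (Ici 0)) (hF : ContinuousOn F (Ici 0))
    (hU' : ∀ t, 0 < t → HasDerivAt U (U' t) t) (hF' : ∀ t, 0 < t → HasDerivAt F (F' t) t)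
    (hle : ∀ t, 0 < t → ‖U' t‖ ^ 2 ≤ -F' t) {κ : ℝ} (hκ : 0 < κ) {T : ℝ} (hT : 0 < T) :
    ‖U T - U 0‖ ≤ κ * T / 2 + (F 0 - F T) / (2 * κ) := by
  -- Derivatives exist only for positive times, so the bound starts at s > 0 and then s → 0 by
  -- continuity. The pointwise inequality ‖U'‖ ≤ κ/2 + ‖U'‖²/(2κ) replaces Cauchy–Schwarz in time
  -- and avoids integrating U'.
  have hs : ∀ s ∈ Ioc 0 T, ‖U T - U s‖ ≤ κ * (T - s) / 2 + (F s - F T) / (2 * κ) := by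
    intro s hs
    refine image_norm_le_of_norm_deriv_right_le_deriv_boundary' (a := s) (b := T)
      (f := fun t => U t - U s) (f' := U')
      (B := fun t => κ * (t - s) / 2 + (F s - F t) / (2 * κ))
      (B' := fun t => κ * 1 / 2 + (-F' t) / (2 * κ)) ?_ ?_ (by simp) ?_ ?_ ?_
      (right_mem_Icc.2 hs.2)
    · exact (hU.mono fun t ht => hs.1.le.trans ht.1).sub continuousOn_const
    · exact fun t ht => ((hU' t (hs.1.trans_le ht.1)).sub_const _).hasDerivWithinAt
    · have := hF.mono (fun t ht => hs.1.le.trans ht.1 : Icc s T ⊆ Ici 0)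
      fun_prop
    · exact fun t ht => (((((hasDerivAt_id t).sub_const s).const_mul κ).div_const 2).add
        (((hF' t (hs.1.trans_le ht.1)).const_sub (F s)).div_const (2 * κ))).hasDerivWithinAt
    · intro t ht
      have h1 := hle t (hs.1.trans_le ht.1)
      have h2 : ‖U' t‖ ^ 2 / (2 * κ) ≤ (-F' t) / (2 * κ) := by gcongr
      have h3 : κ * 1 / 2 + ‖U' t‖ ^ 2 / (2 * κ) - ‖U' t‖ = (κ - ‖U' t‖) ^ 2 / (2 * κ) := by
        field_simp; ring
      have h4 : 0 ≤ (κ - ‖U' t‖) ^ 2 / (2 * κ) := by positivity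
      linarith
  have hmono : 𝓝[>] (0 : ℝ) ≤ 𝓝[Ici 0] 0 := nhdsWithin_mono _ Ioi_subset_Ici_self
  have hU0 := (hU 0 self_mem_Ici).tendsto.mono_left hmono
  have hF0 := (hF 0 self_mem_Ici).tendsto.mono_left hmono
  have hid : Tendsto (fun s : ℝ => s) (𝓝[>] 0) (𝓝 0) := nhdsWithin_le_nhds
  have hR : Tendsto (fun s => κ * (T - s) / 2 + (F s - F T) / (2 * κ)) (𝓝[>] 0)
      (𝓝 (κ * (T - 0) / 2 + (F 0 - F T) / (2 * κ))) :=
    (((hid.const_sub T).const_mul κ).div_const 2).add ((hF0.sub_const _).div_const _)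
  rw [sub_zero] at hR
  refine le_of_tendsto_of_tendsto (hU0.const_sub (U T)).norm hR ?_
  filter_upwards [Ioc_mem_nhdsGT hT] with s hs' using hs s hs'

/-- Continuation argument: as long as the dissipation is controlled near the starting point, the
curve stays there. -/
theorem norm_sub_le_of_controlled_dissipation (hU : ContinuousOn U (Ici 0))
    (hF : ContinuousOn F (Ici 0)) (hU' : ∀ t, 0 < t → HasDerivAt U (U' t) t)
    (hF' : ∀ t, 0 < t → HasDerivAt F (F' t) t) (hle : ∀ t, 0 < t → ‖U' t‖ ^ 2 ≤ -F' t)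
    {δ M T : ℝ} (hδ : 0 < δ) (hM : 0 < M) (hMT : M * T ≤ δ ^ 2 / 4)
    (hc : ∀ t, 0 ≤ t → ‖U t - U 0‖ ≤ δ → F 0 - F t ≤ M) {t : ℝ} (ht : 0 ≤ t) (htT : t ≤ T) :
    ‖U t - U 0‖ ≤ δ := by
  by_contra! hcon
  have hcont : ContinuousOn (fun s => ‖U s - U 0‖) (Icc 0 t) :=
    ((hU.mono fun s hs => hs.1).sub continuousOn_const).norm
  obtain ⟨s, hs, hs'⟩ := intermediate_value_Icc ht hcont ⟨by simpa using hδ.le, hcon.le⟩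
  have hs'' : ‖U s - U 0‖ = δ := hs'
  have hs0 : 0 < s := by
    rcases hs.1.eq_or_lt with h | h
    · rw [← h, sub_self, norm_zero] at hs''; exact absurd hs'' hδ.ne
    · exact h
  -- With this κ both terms of the bound are at most δ/4, so the curve cannot be at distance δ at
  -- time `s`.
  have h1 := norm_sub_le_of_dissipation hU hF hU' hF' hle (κ := 2 * M / δ) (by positivity) hs0
  have h2 : 2 * M / δ * s / 2 ≤ δ / 4 := by
    have h3 : M * s ≤ δ ^ 2 / 4 := (mul_le_mul_of_nonneg_left (hs.2.trans htT) hM.le).trans hMT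
    have h4 : 2 * M / δ * s / 2 = M * s / δ := by ring
    rw [h4, div_le_iff₀ hδ]
    nlinarith
  have h5 : (F 0 - F s) / (2 * (2 * M / δ)) ≤ δ / 4 := by
    have h6 := hc s hs0.le hs''.le
    have h7 : δ / 4 = M / (2 * (2 * M / δ)) := by field_simp; norm_num
    rw [h7]
    gcongr
  rw [hs''] at h1
  linarith

/-- A derivative of constant sign of a function continuous up to the end points is automatically
integrable. No regularity of `n` is required, since it is only dominated pointwise. -/
theorem lintegral_le_of_dissipation (hF : ContinuousOn F (Ici 0))
    (hF' : ∀ t, 0 < t → HasDerivAt F (F' t) t) (hneg : ∀ t, 0 < t → F' t ≤ 0) {T : ℝ}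
    (hT : 0 ≤ T) {n : ℝ → ENNReal} (hn : ∀ t, 0 < t → n t ≤ ENNReal.ofReal (-F' t)) :
    ∫⁻ t in Ioo 0 T, n t ≤ ENNReal.ofReal (F 0 - F T) := by
  have hc : ContinuousOn (fun t => -F t) (Icc 0 T) := (hF.mono fun t ht => ht.1).neg
  have hd : ∀ t ∈ Ioo 0 T, HasDerivAt (fun t => -F t) (-F' t) t := fun t ht => (hF' t ht.1).neg
  have hint := intervalIntegral.integrableOn_deriv_of_nonneg hc hd
    fun t ht => neg_nonneg.2 (hneg t ht.1)
  have heq := intervalIntegral.integral_eq_sub_of_hasDerivAt_of_le hT hc hd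
    ((intervalIntegrable_iff_integrableOn_Ioc_of_le hT).2 hint)
  have hint' : IntegrableOn (fun t => -F' t) (Ioo 0 T) := hint.mono_set Ioo_subset_Ioc_self
  calc _ ≤ ∫⁻ t in Ioo 0 T, ENNReal.ofReal (-F' t) :=
        setLIntegral_mono' measurableSet_Ioo fun t ht => hn t ht.1
    _ = ENNReal.ofReal (∫ t in Ioo 0 T, -F' t) := by
        rw [ofReal_integral_eq_lintegral_ofReal hint']
        rw [EventuallyLE, ae_restrict_iff' measurableSet_Ioo]
        exact Eventually.of_forall fun t ht => neg_nonneg.2 (hneg t ht.1)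
    _ = ENNReal.ofReal (F 0 - F T) := by
        rw [← integral_Ioc_eq_integral_Ioo, ← intervalIntegral.integral_of_le hT, heq]
        congr 1
        ring

end Dissipation

/-! ### From the energy bound to the bound of the time derivative -/

section Final

variable {D f : ℝ → ℝ} {I : Set ℝ} {d α β a b ε : ℝ}

/-- Needed because the initial condition identifies `u 0` with the datum on `[a, b]` only. -/
theorem energy_congr (hab : a ≤ b) {w w' : ℝ → ℝ} (h : ∀ x ∈ Icc a b, w x = w' x) :
    energy D f α a b ε w = energy D f α a b ε w' := by
  refine intervalIntegral.integral_congr fun x hx => ?_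
  rw [uIcc_of_le hab] at hx
  have : dx a b w x = dx a b w' x := derivWithin_congr h (h x hx)
  simp only [this, h x hx]

/-- Only one summand has to be measurable; in the application the other contains `v`, whose
measurability is not established. -/
theorem normL_one_add_le {p q : ℝ → ℝ} (hp : AEStronglyMeasurable p (volume.restrict (Ioo a b))) :
    normL a b 1 (fun x => p x + q x) ≤ normL a b 1 p + normL a b 1 q := by
  simp only [normL, eLpNorm_one_eq_lintegral_enorm]
  rw [← lintegral_add_left' hp.enorm]
  exact lintegral_mono fun x => enorm_add_le _ _

theorem normL_one_le (hab : a ≤ b) {p : ℝ → ℝ}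
    (hp : AEStronglyMeasurable p (volume.restrict (Ioo a b))) :
    normL a b 1 p ≤ normL a b 2 p * ENNReal.ofReal (Real.sqrt (b - a)) := by
  refine (eLpNorm_le_eLpNorm_mul_rpow_measure_univ (q := 2) (by norm_num) hp).trans_eq ?_
  rw [Real.sqrt_eq_rpow, Measure.restrict_apply_univ, Real.volume_Ioo]
  rw [ENNReal.ofReal_rpow_of_nonneg (sub_nonneg.2 hab) (by norm_num)]
  norm_num
  rfl

/-- The bound of the time derivative for one solution that starts near a state of almost minimal
energy `m`. -/
theorem lintegral_ut_le (H : IsModel D f I d α β) (hab : a < b) (hε : 0 < ε) {u₀ v : ℝ → ℝ}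
    {u ut : ℝ → ℝ → ℝ} (hS : IsSolution D f I a b ε u₀ u ut) {δ m e T : ℝ} (hδ : 0 < δ)
    (he : 0 < e)
    (hlow : ∀ w : ℝ → ℝ, MemH1 a b w → (∀ x ∈ Icc a b, w x ∈ I) →
      normL a b 1 (fun x => w x - v x) < ENNReal.ofReal δ → m ≤ energy D f α a b ε w)
    (hu₀ : normL a b 1 (fun x => u₀ x - v x) < ENNReal.ofReal (δ / 2))
    (hE : energy D f α a b ε u₀ ≤ m + e) (hT : 0 ≤ T)
    (hTe : ε / d * e * T ≤ (δ / (2 * Real.sqrt (b - a))) ^ 2 / 4) :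
    ∫⁻ t in Ioo 0 T, normL a b 2 (ut t) ^ 2 ≤ ENNReal.ofReal (ε / d * e) := by
  have hd := H.d_pos
  have hsq : 0 < Real.sqrt (b - a) := Real.sqrt_pos.2 (sub_pos.2 hab)
  -- By Cauchy–Schwarz an L² distance η is an L¹ distance at most δ/2. The other half of δ is the
  -- distance of the datum from `v`.
  set η := δ / (2 * Real.sqrt (b - a)) with hη
  have hη0 : 0 < η := by positivity
  have hm : ∀ s, 0 ≤ s → MemLp (u s) 2 (volume.restrict (Ioo a b)) := fun s hs =>
    (hS.memH1 s hs).memLp hab.le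
  -- The factor ε/d normalizes the energy identity to ‖u_t‖² ≤ -F'.
  set F : ℝ → ℝ := fun t => ε / d * energy D f α a b ε (u t) with hFdef
  set F' : ℝ → ℝ := fun t => ε / d * -(ε⁻¹ * ∫ x in Ioo a b, D (u t x) * ut t x * ut t x) with hF'def
  have hF : ContinuousOn F (Ici 0) := continuousOn_const.mul (continuousOn_energy H hab hS)
  have hF' : ∀ t, 0 < t → HasDerivAt F (F' t) t := fun t ht =>
    (hasDerivAt_energy H hab hε hS ht).const_mul _
  have hbd : ∀ t, 0 < t → ∫ x in Ioo a b, ut t x * ut t x ≤ -F' t := by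
    intro t ht
    have h1 := mul_integral_ut_sq_le H hab hS ht
    have h2 : -F' t = (∫ x in Ioo a b, D (u t x) * ut t x * ut t x) / d := by
      rw [hF'def]; field_simp
    rw [h2, le_div_iff₀ hd]
    linarith
  have hnn : ∀ t, 0 ≤ ∫ x in Ioo a b, ut t x * ut t x := fun t =>
    integral_nonneg fun _ => mul_self_nonneg _
  have hE0 : energy D f α a b ε (u 0) ≤ m + e := by
    rwa [energy_congr hab.le hS.initial]
  have hc : ∀ t, 0 ≤ t → ‖toL2 a b (u t) - toL2 a b (u 0)‖ ≤ η → F 0 - F t ≤ ε / d * e := by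
    intro t ht hle
    have hdm : MemLp (fun x => u t x - u 0 x) 2 (volume.restrict (Ioo a b)) :=
      (hm t ht).sub (hm 0 le_rfl)
    rw [toL2_sub (hm t ht) (hm 0 le_rfl), norm_toL2 hdm] at hle
    have h2 : normL a b 2 (fun x => u t x - u 0 x) ≤ ENNReal.ofReal η :=
      (ENNReal.le_ofReal_iff_toReal_le hdm.2.ne hη0.le).2 hle
    have h3 : normL a b 1 (fun x => u t x - u 0 x) ≤ ENNReal.ofReal (δ / 2) := by
      refine (normL_one_le hab.le hdm.1).trans ((mul_le_mul_left h2 _).trans_eq ?_)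
      rw [← ENNReal.ofReal_mul hη0.le]
      congr 1
      rw [hη]
      field_simp
    have h4 : normL a b 1 (fun x => u 0 x - v x) < ENNReal.ofReal (δ / 2) := by
      refine lt_of_eq_of_lt (eLpNorm_congr_ae ?_) hu₀
      filter_upwards [ae_restrict_mem measurableSet_Ioo] with x hx
      rw [hS.initial x (Ioo_subset_Icc_self hx)]
    have h5 : normL a b 1 (fun x => u t x - v x) < ENNReal.ofReal δ := by
      have h6 := normL_one_add_le (q := fun x => u 0 x - v x) hdm.1
      simp only [sub_add_sub_cancel] at h6
      refine h6.trans_lt ((ENNReal.add_lt_add_of_le_of_lt (h3.trans_lt ENNReal.ofReal_lt_top).ne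
        h3 h4).trans_eq ?_)
      rw [← ENNReal.ofReal_add (by positivity) (by positivity), add_halves]
    have h6 := hlow (u t) (hS.memH1 t ht) (hS.mem_I t ht) h5
    rw [hFdef, ← mul_sub]
    refine mul_le_mul_of_nonneg_left ?_ (by positivity)
    linarith
  have hle := norm_sub_le_of_controlled_dissipation (continuousOn_toL2 hab hS) hF
    (fun t ht => hasDerivAt_toL2 hab hS ht) hF'
    (fun t ht => (norm_toL2_sq (hS.memL2_ut t ht)).trans_le (hbd t ht)) hη0 (by positivity) hTe hc
    hT le_rfl
  refine (lintegral_le_of_dissipation hF hF' (fun t ht => ?_) hT fun t ht => ?_).trans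
    (ENNReal.ofReal_le_ofReal (hc T hT hle))
  · linarith [hbd t ht, hnn t]
  · rw [normL_two_sq (hS.memL2_ut t ht)]
    exact ENNReal.ofReal_le_ofReal (hbd t ht)

end Final

end AllenCahn

theorem mainTheorem3
    -- the equation: diffusivity `D`, reaction `f`, phases `α < β`, space interval `[a, b]`
    (D f : ℝ → ℝ) (I : Set ℝ) (d α β a b : ℝ)
    (hIopen : IsOpen I) (hIconn : I.OrdConnected)
    (hab : a < b) (hαβ : α < β) (hαβI : Icc α β ⊆ I)
    (hD : ContDiffOn ℝ 2 D I) (hf : ContDiffOn ℝ 2 f I)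
    (hd : 0 < d) (hDd : ∀ u ∈ I, d ≤ D u)
    (hfα : f α = 0) (hfβ : f β = 0) (hfα' : 0 < deriv f α) (hfβ' : 0 < deriv f β)
    (hint0 : ∫ s in α..β, f s * D s = 0)
    (hint1 : ∀ u ∈ I, u ≠ α → u ≠ β → 0 < ∫ s in α..u, f s * D s)
    -- the step function `v` with `N` jumps and the exponent `A`
    (N : ℕ) (h : Fin N → ℝ) (r : ℝ) (v : ℝ → ℝ)
    (hv : AllenCahn.IsStep a b α β N h r v)
    (A : ℝ) (hA : 0 < A) (hA' : A < r * Real.sqrt (2 * AllenCahn.lam D f α β))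
    -- the initial data `u₀ ε`
    (u₀ : ℝ → ℝ → ℝ)
    (hu₀H1 : ∀ᶠ ε in 𝓝[>] (0 : ℝ), AllenCahn.MemH1 a b (u₀ ε))
    (hu₀I : ∀ᶠ ε in 𝓝[>] (0 : ℝ), ∃ M₁ M₂ : ℝ, M₁ < M₂ ∧ Icc M₁ M₂ ⊆ I ∧
      ∀ x ∈ Icc a b, M₁ ≤ u₀ ε x ∧ u₀ ε x ≤ M₂)
    (hu₀v : Tendsto (fun ε => AllenCahn.normL a b 1 (fun x => u₀ ε x - v x))
      (𝓝[>] (0 : ℝ)) (𝓝 0))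
    (hu₀E : ∃ C : ℝ, 0 < C ∧ ∀ᶠ ε in 𝓝[>] (0 : ℝ),
      AllenCahn.energy D f α a b ε (u₀ ε) ≤
        N * AllenCahn.gammaZero D f α β + C * Real.exp (-A / ε)) :
    ∃ ε₀ C₁ C₂ : ℝ, 0 < ε₀ ∧ 0 < C₁ ∧ 0 < C₂ ∧
      ∀ ε ∈ Ioo 0 ε₀, ∀ u ut : ℝ → ℝ → ℝ,
        AllenCahn.IsSolution D f I a b ε (u₀ ε) u ut →
        ∫⁻ t in Ioo 0 (C₁ * ε⁻¹ * Real.exp (A / ε)), AllenCahn.normL a b 2 (ut t) ^ 2 ≤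
          ENNReal.ofReal (C₂ * ε * Real.exp (-A / ε)) := by
  have H : AllenCahn.IsModel D f I d α β := ⟨hIopen, hIconn, hαβ, hαβI, hD, hf, hd, hDd, hfα, hfβ,
    hfα', hfβ', hint0, hint1⟩
  obtain ⟨C, hC, hu₀C⟩ := hu₀E
  obtain ⟨δ, hδ, C', hC', hlow⟩ := AllenCahn.exists_energy_lower_bound H hab hv hA hA'
  have hsmall := hu₀v.eventually_lt_const
    (show (0 : ENNReal) < ENNReal.ofReal (δ / 2) by simpa using hδ)
  obtain ⟨ε₀, hε₀, hsub⟩ := mem_nhdsGT_iff_exists_Ioo_subset.1 (hsmall.and hu₀C)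
  have hsq : 0 < Real.sqrt (b - a) := Real.sqrt_pos.2 (sub_pos.2 hab)
  set η := δ / (2 * Real.sqrt (b - a)) with hη
  have hη0 : 0 < η := by positivity
  -- The admissible energy drop is (C + C') e^{-A/ε}: the excess of the datum plus the error of the
  -- lower bound. The first constant makes (ε/d) times this drop times T equal to η²/4, the limit of
  -- the continuation argument.
  refine ⟨ε₀, d * η ^ 2 / (4 * (C + C')), (C + C') / d, hε₀, by positivity, by positivity,
    fun ε hε u ut hS => ?_⟩
  obtain ⟨h1, h2⟩ := hsub hε
  have hε0 : 0 < ε := hε.1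
  have hexp : Real.exp (-A / ε) * Real.exp (A / ε) = 1 := by
    rw [← Real.exp_add, neg_div, neg_add_cancel, Real.exp_zero]
  have hmain := AllenCahn.lintegral_ut_le H hab hε0 hS (v := v) (δ := δ)
    (m := N * AllenCahn.gammaZero D f α β - C' * Real.exp (-A / ε))
    (e := (C + C') * Real.exp (-A / ε))
    (T := d * η ^ 2 / (4 * (C + C')) * ε⁻¹ * Real.exp (A / ε)) hδ (by positivity)
    (fun w hw hwI hwv => hlow ε hε0 w hw hwI hwv) h1 (by linarith) (by positivity) ?_
  · refine hmain.trans_eq (congrArg _ ?_)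
    ring
  · refine le_of_eq ?_
    have : ε / d * ((C + C') * Real.exp (-A / ε)) *
        (d * η ^ 2 / (4 * (C + C')) * ε⁻¹ * Real.exp (A / ε)) =
        (Real.exp (-A / ε) * Real.exp (A / ε)) * (η ^ 2 / 4) := by
      field_simp
    rw [this, hexp, one_mul]
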